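/- Let $p>2$ be a prime, $\mathbb F$ a field of characteristic $p$, and $M=(c_{ij})\in\mathbb F^{2\times 4}$. Let $E=\langle e_1,e_2,e_3,e_4\rangle\cong(\mathbb Z/p)^4$ act on $\mathbb F[V_M]=\mathbb F[x,y,z]$ by algebra automorphisms with $$x\cdot e_j=x,\qquad y\cdot e_j=y+c_{1j}x,\qquad z\cdot e_j=z+2c_{1j}y+(c_{1j}^2+c_{2j})x ,$$ and let $\mathbb F[V_M]^E$ be the ring of invariants. For $f\in\mathbb F[x,y,z]$ let $N_M(f)$ be the product of the elements of the $E$-orbit of $f$. Let $\Gamma$ be the $10\times4$ matrix whose rows $2k+1$ and $2k+2$ ($0\le k\le4$) are $(c_{1j}^{p^k})_{j}$ and $(c_{2j}^{p^k})_{j}$, and let $\gamma_{ijk\ell}$ be its $4\times 4$ minor on rows $i,j,k,\ell$. Use the graded reverse lexicographic order with $x<y<z$; $\mathrm{LM}$ and $\mathrm{LT}$ denote lead monomial and lead term. A subset $\mathcal B$ of a subalgebra $A\subseteq\mathbb F[x,y,z]$ is a SAGBI basis for $A$ if the lead monomials of the elements of $\mathcal B$ generate the algebra generated by the lead monomials of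 all non-zero elements of $A$. For a finite family $h=(h_j)$ write $h^I=\prod_j h_j^{I_j}$. A non-trivial tête-à-tête is a pair $(h^I,h^J)$ with $\mathrm{LM}(h^I)=\mathrm{LM}(h^J)$ and $I,J$ of disjoint support. It subducts to zero if, with $c\in\mathbb F$ such that $\mathrm{LT}(h^I)=\mathrm{LT}(c\,h^J)$, the polynomial $h^I-c\,h^J$ can be reduced to $0$ in finitely many steps, each subtracting some $c_kh^{I_k}$ with the same lead term as the current (non-zero) polynomial; the corresponding relation is $T^I-c\,T^J-\sum_k c_kT^{I_k}$ in the polynomial ring $\mathbb F[T_j]$. Assume $\gamma_{1234}\ne0$, $\gamma_{1235}=0$, $\gamma_{1357}\neq 0$ and $\gamma_{1245}\ne0$ (these imply $\gamma_{1345}\neq0$). With $\delta=y^2-xz$ put $$\hat f_1=y^{p^2}+\tfrac{\gamma_{1245}}{\gamma_{1234}}y^px^{p^2-p}+\tfrac{\gamma_{1345}}{\gamma_{1234}}\delta x^{p^2-2}+\tfrac{\gamma_{2345}}{\gamma_{1234}}yx^{p^2-1},$$ $$\tilde h_2=N_M(y)-\hat f_1^{\,p^2}+\Bigl(\tfrac{\gamma_{1359}}{\gamma_{1357}}+\tfrac{\gamma_{1245}^{p^2}}{\gamma_{1234}^{p^2}}\Bigr)\hat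 f_1^{\,p}x^{p^4-p^3}+\tfrac{\gamma_{1345}^{p^2}}{\gamma_{1234}^{p^2}}\hat f_1^{\,2}x^{p^4-2p^2},\qquad h_2=\frac{\gamma_{1234}^{p^2+1}\,\tilde h_2}{2x^{p^4-p^2-p}\gamma_{1345}^{p^2}\gamma_{1245}},$$ $$\tilde h_3=\hat f_1^{\,p+1}-h_2^p+\Bigl(\tfrac{\gamma_{1345}}{\gamma_{1245}}\Bigr)^p\hat f_1^{\,p-2}h_2^2x^{p^2-2p},\qquad h_3=\frac{\gamma_{1245}^{p+1}\,\tilde h_3}{2\gamma_{1345}^{p+1}x^{p^2-p-2}}.$$ Then the divisions by powers of $x$ are exact, so $h_2,h_3\in\mathbb F[x,y,z]$, and: 1. $\mathcal B=\{x,\hat f_1,h_2,h_3,N_M(z)\}$ is a SAGBI basis for $\mathbb F[V_M]^E$ and generates it as an $\mathbb F$-algebra; its elements are non-zero and homogeneous of degrees $1$, $p^2$, $p^2+p$, $p^3+p+2$, $p^4$ respectively. 2. $\mathbb F[V_M]^E$ is a complete intersection (it has a finite presentation whose ideal of relations is generated by a regular sequence), with generating relations coming from the subduction of the tête-à-têtes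 $(h_2^p,\hat f_1^{\,p+1})$ and $(h_3^p,\hat f_1^{\,p^2-1}h_2^2)$. That is: both are non-trivial tête-à-têtes for $\mathcal B$ that subduct to zero using $\mathcal B$, and, for any choice of such subductions, the two corresponding relations $r_1,r_2\in\mathbb F[T_0,\dots,T_4]$ form a regular sequence $(r_1,r_2)$ generating the kernel of the map $\mathbb F[T_0,\dots,T_4]\to\mathbb F[x,y,z]$ sending the $T_i$ to $x,\hat f_1,h_2,h_3,N_M(z)$. With $T_i$ given the degree of the corresponding generator, $r_1$ and $r_2$ are homogeneous of degrees $p^3+p^2$ and $p^4+p^2+2p$. -/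

import Mathlib

namespace RankFourInvariants

open MvPolynomial

noncomputable section

/-! ### The graded reverse lexicographic order

The polynomial ring `F[x, y, z]` is `MvPolynomial (Fin 3) F` with `z = X 0`, `y = X 1`, `x = X 2`.
This numbering matches the matrix convention `z = [1 0 0]`, `y = [0 1 0]`, `x = [0 0 1]`. -/

/-- Exponent vectors, to be ordered by grevlex with `x < y < z`. -/
def GrevLex : Type := Fin 3 →₀ ℕ

/-- The identity map, from an exponent vector to the type synonym. -/
def toGrevLex : (Fin 3 →₀ ℕ) ≃ GrevLex := Equiv.refl _

/-- The identity map, from the type synonym to exponent vectors. -/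
def ofGrevLex : GrevLex ≃ (Fin 3 →₀ ℕ) := Equiv.refl _

instance : AddCommMonoid GrevLex := ofGrevLex.addCommMonoid

theorem ofGrevLex_add (a b : GrevLex) : ofGrevLex (a + b) = ofGrevLex a + ofGrevLex b := rfl

/-- The three partial sums `(a₀ + a₁ + a₂, a₀ + a₁, a₀)`, compared lexicographically.
In a fixed total degree, a larger `a₀ + a₁` means a smaller exponent `a₂` of `x`, and then a
larger `a₀` means a smaller exponent `a₁` of `y`; see `grevlex_lt_iff`. -/
def grevKey (a : GrevLex) : ℕ ×ₗ ℕ ×ₗ ℕ :=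
  toLex (ofGrevLex a 0 + ofGrevLex a 1 + ofGrevLex a 2,
    toLex (ofGrevLex a 0 + ofGrevLex a 1, ofGrevLex a 0))

theorem grevKey_injective : Function.Injective grevKey := by
  intro a b h
  have h' := congrArg (fun t => ((ofLex t).1, (ofLex (ofLex t).2).1, (ofLex (ofLex t).2).2)) h
  simp only [grevKey, ofLex_toLex, Prod.mk.injEq] at h'
  obtain ⟨h1, h2, h3⟩ := h'
  refine ofGrevLex.injective (Finsupp.ext fun i => ?_)
  fin_cases i <;> simp <;> omega

theorem grevKey_add (a b : GrevLex) : grevKey (a + b) = grevKey a + grevKey b := by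
  simp only [grevKey, ofGrevLex_add, Finsupp.add_apply, ← toLex_add, Prod.mk_add_mk]
  refine congrArg toLex (Prod.ext ?_ (congrArg toLex (Prod.ext ?_ ?_))) <;> simp only <;> omega

instance : LinearOrder GrevLex := LinearOrder.lift' grevKey grevKey_injective

theorem grevKey_le {a b : GrevLex} : grevKey a ≤ grevKey b ↔ a ≤ b := Iff.rfl

theorem grevKey_lt {a b : GrevLex} : grevKey a < grevKey b ↔ a < b := Iff.rfl

instance : IsOrderedAddMonoid GrevLex where
  add_le_add_left a b h c := by
    rw [← grevKey_le] at h ⊢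
    rw [grevKey_add, grevKey_add]
    exact add_le_add_left h _

instance : WellFoundedLT GrevLex :=
  ⟨(InvImage.wf grevKey (wellFounded_lt (α := ℕ ×ₗ ℕ ×ₗ ℕ)))⟩

/-- The graded reverse lexicographic order on monomials in `x, y, z`, with `x < y < z`. -/
def grevlex : MonomialOrder (Fin 3) where
  syn := GrevLex
  toSyn := { toEquiv := toGrevLex, map_add' := fun _ _ => rfl }
  toSyn_monotone a b h := by
    have h0 := h 0
    have h1 := h 1
    have h2 := h 2
    change grevKey (toGrevLex a) ≤ grevKey (toGrevLex b)
    have e : ∀ c : Fin 3 →₀ ℕ, ofGrevLex (toGrevLex c) = c := fun _ => rfl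
    simp only [grevKey, e, Prod.Lex.toLex_le_toLex]
    omega

theorem grevlex_lt_iff (a b : Fin 3 →₀ ℕ) :
    grevlex.toSyn a < grevlex.toSyn b ↔
      a 0 + a 1 + a 2 < b 0 + b 1 + b 2 ∨
        a 0 + a 1 + a 2 = b 0 + b 1 + b 2 ∧ (b 2 < a 2 ∨ b 2 = a 2 ∧ b 1 < a 1) := by
  change grevKey (toGrevLex a) < grevKey (toGrevLex b) ↔ _
  have e : ∀ c : Fin 3 →₀ ℕ, ofGrevLex (toGrevLex c) = c := fun _ => rfl
  simp only [grevKey, e, Prod.Lex.toLex_lt_toLex]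
  omega

variable {F : Type*} [Field F]

/-- The lead monomial `LM(f)` (used for `f ≠ 0`). -/
def leadMonomial (f : MvPolynomial (Fin 3) F) : MvPolynomial (Fin 3) F :=
  monomial (grevlex.degree f) 1

/-- The lead term `LT(f)`. -/
def leadTerm (f : MvPolynomial (Fin 3) F) : MvPolynomial (Fin 3) F :=
  grevlex.leadingTerm f

/-- `B` is a SAGBI basis for `A`: it is a subset of `A` whose lead monomials generate the lead
term algebra of `A`. -/
def IsSagbiBasis (B : Set (MvPolynomial (Fin 3) F))
    (A : Subalgebra F (MvPolynomial (Fin 3) F)) : Prop :=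
  B ⊆ A ∧
    Algebra.adjoin F (leadMonomial '' {f | f ∈ B ∧ f ≠ 0}) =
      Algebra.adjoin F (leadMonomial '' {f | f ∈ A ∧ f ≠ 0})

/-- The power product `h^I = ∏ j, (h j) ^ (I j)` of a finite family. -/
def powerProduct {n : ℕ} (h : Fin n → MvPolynomial (Fin 3) F) (I : Fin n →₀ ℕ) :
    MvPolynomial (Fin 3) F :=
  ∏ j, h j ^ I j

/-- `(h^I, h^J)` is a non-trivial tête-à-tête: the lead monomials agree and `I`, `J` have disjoint
supports. -/
def IsNontrivialTeteATete {n : ℕ} (h : Fin n → MvPolynomial (Fin 3) F) (I J : Fin n →₀ ℕ) :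
    Prop :=
  leadMonomial (powerProduct h I) = leadMonomial (powerProduct h J) ∧
    Disjoint I.support J.support

/-- `SubductsToZero h f P`: the polynomial `f` can be subducted to zero using the family `h`, by
successively subtracting `c * h^I` with the same lead term as the current polynomial, and `P` is
the formal sum of the terms that were subtracted (so `f = P(h)`). -/
inductive SubductsToZero {n : ℕ} (h : Fin n → MvPolynomial (Fin 3) F) :
    MvPolynomial (Fin 3) F → MvPolynomial (Fin n) F → Prop
  | zero : SubductsToZero h 0 0
  | step (f : MvPolynomial (Fin 3) F) (I : Fin n →₀ ℕ) (c : F) (P : MvPolynomial (Fin n) F)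
      (hf : f ≠ 0) (hlt : leadTerm f = leadTerm (C c * powerProduct h I))
      (hP : SubductsToZero h (f - C c * powerProduct h I) P) :
      SubductsToZero h f (monomial I c + P)

/-- `r` is a relation coming from a subduction of the tête-à-tête `(h^I, h^J)` to zero: with `c`
chosen so that `LT(h^I) = LT(c h^J)`, the polynomial `h^I - c h^J` subducts to zero and
`r = T^I - c T^J - P(T)`, where `P` records the subduction. -/
def IsSubductionRelation {n : ℕ} (h : Fin n → MvPolynomial (Fin 3) F) (I J : Fin n →₀ ℕ)
    (r : MvPolynomial (Fin n) F) : Prop :=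
  ∃ (c : F) (P : MvPolynomial (Fin n) F),
    leadTerm (powerProduct h I) = leadTerm (C c * powerProduct h J) ∧
    SubductsToZero h (powerProduct h I - C c * powerProduct h J) P ∧
    r = monomial I 1 - monomial J c - P

/-- An `F`-algebra is a complete intersection if it has a presentation by finitely many generators
whose ideal of relations is generated by a regular sequence. -/
def IsCompleteIntersection (F : Type*) [Field F] (A : Type*) [CommRing A] [Algebra F A] : Prop :=
  ∃ (n : ℕ) (φ : MvPolynomial (Fin n) F →ₐ[F] A) (rs : List (MvPolynomial (Fin n) F)),
    Function.Surjective φ ∧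
    RingTheory.Sequence.IsRegular (MvPolynomial (Fin n) F) rs ∧
    RingHom.ker φ = Ideal.ofList rs

/-! ### The representation `V_M` and its invariants -/

/-- The matrix `σ(c₁, c₂)`. -/
def sigma (c₁ c₂ : F) : Matrix (Fin 3) (Fin 3) F :=
  !![1, 2 * c₁, c₁ ^ 2 + c₂; 0, 1, c₁; 0, 0, 1]

theorem sigma_zero : sigma (0 : F) 0 = 1 := by
  ext i j
  fin_cases i <;> fin_cases j <;> simp [sigma]

theorem sigma_add (c₁ c₂ d₁ d₂ : F) :
    sigma (c₁ + d₁) (c₂ + d₂) = sigma c₁ c₂ * sigma d₁ d₂ := by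
  ext i j
  fin_cases i <;> fin_cases j <;>
    simp [sigma, Matrix.mul_apply, Fin.sum_univ_three] <;> ring

variable (p : ℕ) [Fact p.Prime] [CharP F p] (M : Matrix (Fin 2) (Fin 4) F)

/-- The `𝔽_p`-linear combination `∑ j, g_j c_{ij}` of the entries of row `i` of `M`. -/
def rowComb (i : Fin 2) (g : Fin 4 → ZMod p) : F :=
  ∑ j, ZMod.castHom (dvd_refl p) F (g j) * M i j

/-- The elementary abelian group `E ≅ (ℤ/p)⁴`, written multiplicatively. -/
abbrev E (p : ℕ) : Type := Multiplicative (Fin 4 → ZMod p)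

/-- The representation `V_M` of `E`, determined by `e_j ↦ σ(c_{1j}, c_{2j})`; see
`rep_generator`. -/
def rep : E p →* Matrix (Fin 3) (Fin 3) F where
  toFun g := sigma (rowComb p M 0 g.toAdd) (rowComb p M 1 g.toAdd)
  map_one' := by simp [rowComb, sigma_zero]
  map_mul' g h := by
    rw [← sigma_add]
    simp [rowComb, add_mul, Finset.sum_add_distrib]

theorem rep_generator (j : Fin 4) :
    rep p M (Multiplicative.ofAdd (Pi.single j 1)) = sigma (M 0 j) (M 1 j) := by
  have h : ∀ i, rowComb p M i (Pi.single j 1) = M i j := by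
    intro i
    unfold rowComb
    rw [Finset.sum_eq_single j]
    · simp only [Pi.single_eq_same, map_one, one_mul]
    · intro k _ hk
      simp only [Pi.single_eq_of_ne hk, map_zero, zero_mul]
    · simp
  simp [rep, h]

/-- The algebra endomorphism of `F[x, y, z]` given by right multiplication of a matrix on the row
vectors `z = [1 0 0]`, `y = [0 1 0]`, `x = [0 0 1]`. -/
def matrixAct (A : Matrix (Fin 3) (Fin 3) F) :
    MvPolynomial (Fin 3) F →ₐ[F] MvPolynomial (Fin 3) F :=
  aeval fun i => ∑ j, C (A i j) * X j

theorem matrixAct_sigma (c₁ c₂ : F) :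
    matrixAct (sigma c₁ c₂) (X 2) = X 2 ∧
    matrixAct (sigma c₁ c₂) (X 1) = X 1 + C c₁ * X 2 ∧
    matrixAct (sigma c₁ c₂) (X 0) = X 0 + C (2 * c₁) * X 1 + C (c₁ ^ 2 + c₂) * X 2 := by
  simp [matrixAct, sigma, Fin.sum_univ_three]

/-- The action `f ↦ f · g` of `g ∈ E` on `F[V_M] = F[x, y, z]`. -/
def act (g : E p) : MvPolynomial (Fin 3) F →ₐ[F] MvPolynomial (Fin 3) F :=
  matrixAct (rep p M g)

/-- The ring of invariants `F[V_M]^E`. -/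
def invariants : Subalgebra F (MvPolynomial (Fin 3) F) where
  carrier := {f | ∀ g : E p, act p M g f = f}
  mul_mem' ha hb g := by rw [map_mul, ha g, hb g]
  add_mem' ha hb g := by rw [map_add, ha g, hb g]
  algebraMap_mem' c g := (act p M g).commutes c

open Classical in
/-- The norm `N_M(f)`: the product of the elements of the orbit of `f`. -/
def orbitNorm (f : MvPolynomial (Fin 3) F) : MvPolynomial (Fin 3) F :=
  ∏ h ∈ Finset.univ.image (fun g : E p => act p M g f), h

/-! ### The minors `γ_{ijkl}(M)` -/

/-- Row `r` (numbered from `1`) of `Γ(M)`: rows `2k+1` and `2k+2` consist of the `p^k`-th powers of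
the entries of the first and of the second row of `M`. -/
def gammaRow (p : ℕ) (M : Matrix (Fin 2) (Fin 4) F) (r : ℕ) (j : Fin 4) : F :=
  (if r % 2 = 1 then M 0 j else M 1 j) ^ p ^ ((r - 1) / 2)

/-- The minor `γ_{ijkl}(M)` of `Γ(M)` given by the rows `i, j, k, l` (numbered from `1`). -/
def gam (p : ℕ) (M : Matrix (Fin 2) (Fin 4) F) (i j k l : ℕ) : F :=
  Matrix.det (Matrix.of ![gammaRow p M i, gammaRow p M j, gammaRow p M k, gammaRow p M l])

/-! ### The generators -/

/-- `δ = y² - x z`. -/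
def delta : MvPolynomial (Fin 3) F := X 1 ^ 2 - X 2 * X 0

/-- `f̂₁ = y^{p²} + (γ₁₂₄₅/γ₁₂₃₄) y^p x^{p²-p} + (γ₁₃₄₅/γ₁₂₃₄) δ x^{p²-2}
+ (γ₂₃₄₅/γ₁₂₃₄) y x^{p²-1}`. -/
def fHat₁ (p : ℕ) (M : Matrix (Fin 2) (Fin 4) F) : MvPolynomial (Fin 3) F :=
  X 1 ^ p ^ 2
    + C (gam p M 1 2 4 5 / gam p M 1 2 3 4) * X 1 ^ p * X 2 ^ (p ^ 2 - p)
    + C (gam p M 1 3 4 5 / gam p M 1 2 3 4) * delta * X 2 ^ (p ^ 2 - 2)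
    + C (gam p M 2 3 4 5 / gam p M 1 2 3 4) * X 1 * X 2 ^ (p ^ 2 - 1)

/-- `h̃₂ = N_M(y) - f̂₁^{p²} + α₁ f̂₁^p x^{p⁴-p³} + α₂ f̂₁² x^{p⁴-2p²}`. -/
def hTilde₂ : MvPolynomial (Fin 3) F :=
  orbitNorm p M (X 1) - fHat₁ p M ^ p ^ 2
    + C (gam p M 1 3 5 9 / gam p M 1 3 5 7
          + gam p M 1 2 4 5 ^ p ^ 2 / gam p M 1 2 3 4 ^ p ^ 2)
        * fHat₁ p M ^ p * X 2 ^ (p ^ 4 - p ^ 3)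
    + C (gam p M 1 3 4 5 ^ p ^ 2 / gam p M 1 2 3 4 ^ p ^ 2)
        * fHat₁ p M ^ 2 * X 2 ^ (p ^ 4 - 2 * p ^ 2)

/-- `h₂ = γ₁₂₃₄^{p²+1} h̃₂ / (2 x^{p⁴-p²-p} γ₁₃₄₅^{p²} γ₁₂₄₅)`. -/
def h₂ : MvPolynomial (Fin 3) F :=
  C (gam p M 1 2 3 4 ^ (p ^ 2 + 1) / (2 * gam p M 1 3 4 5 ^ p ^ 2 * gam p M 1 2 4 5))
    * (hTilde₂ p M).divMonomial (Finsupp.single 2 (p ^ 4 - p ^ 2 - p))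

/-- `h̃₃ = f̂₁^{p+1} - h₂^p + (γ₁₃₄₅/γ₁₂₄₅)^p f̂₁^{p-2} h₂² x^{p²-2p}`. -/
def hTilde₃ : MvPolynomial (Fin 3) F :=
  fHat₁ p M ^ (p + 1) - h₂ p M ^ p
    + C ((gam p M 1 3 4 5 / gam p M 1 2 4 5) ^ p)
        * fHat₁ p M ^ (p - 2) * h₂ p M ^ 2 * X 2 ^ (p ^ 2 - 2 * p)

/-- `h₃ = γ₁₂₄₅^{p+1} h̃₃ / (2 γ₁₃₄₅^{p+1} x^{p²-p-2})`. -/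
def h₃ : MvPolynomial (Fin 3) F :=
  C (gam p M 1 2 4 5 ^ (p + 1) / (2 * gam p M 1 3 4 5 ^ (p + 1)))
    * (hTilde₃ p M).divMonomial (Finsupp.single 2 (p ^ 2 - p - 2))

/-- The family `x, f̂₁, h₂, h₃, N_M(z)`. -/
def gens : Fin 5 → MvPolynomial (Fin 3) F :=
  ![X 2, fHat₁ p M, h₂ p M, h₃ p M, orbitNorm p M (X 0)]

/-- The degrees `1, p², p² + p, p³ + p + 2, p⁴` of the generators. -/
def genDegrees (p : ℕ) : Fin 5 → ℕ :=
  ![1, p ^ 2, p ^ 2 + p, p ^ 3 + p + 2, p ^ 4]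

end

end RankFourInvariants

open RankFourInvariants MvPolynomial

namespace RankFourInvariants

open MvPolynomial

noncomputable section

set_option linter.unusedSectionVars false

variable {F : Type*} [Field F] (p : ℕ) [Fact p.Prime] [CharP F p] (M : Matrix (Fin 2) (Fin 4) F)

/-! ### Linear relations between the rows of `Γ(M)` -/

/-! The invariant f̂₁ contains z only linearly, with coefficient −(γ₁₃₄₅/γ₁₂₃₄) x^{p²-1}. Setting x
= 1 therefore turns F[y, z] into F[t][y] with t = f̂₁, and there E fixes t and translates y by the
p⁴ distinct scalars c₁(g) (`dehom_act`). The polynomials fixed by these translations are the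
polynomials over F[t] in the norm of y, so their y-degrees are multiples of p⁴
(`IsShiftInvariant.exists_comp`).

The construction of h₂ and h₃ cancels lead terms until the cross term of a square survives as the
term of lowest order in x; this gives their lead monomials. On the other side, after x = 1 the
elements h₂, h₃, N_M(z) have y-degrees p⁴, p⁵, p⁶ and unit leading coefficients. If n = a + bp + cp²
with a, b < p, then h₂^a h₃^b N_M(z)^c has y-degree np⁴. Division with remainder shows that these
standard products span the translation invariants over F[t] (`exists_standard_of_isShiftInvariant`).

Homogenizing, some x^k r is a combination of standard power products for each homogeneous invariant
r. Standard power products have distinct lead monomials (`leadExp_injOn`), so nothing cancels, and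
grevlex allows x^k to be divided out term by term (`exists_standard_of_isHomogeneous`). Hence
standard power products span the invariants, and each lead monomial of an invariant is that of a
standard power product: this is both generation and the SAGBI property.

For the relations, order the monomials in the T_i by the lead monomial of their image, breaking ties
in favour of T₃ and then T₂. The two subduction relations then have lead monomials T₂^p and T₃^p,
whatever the subductions. Dividing a relation by them leaves a standard remainder, which must vanish
(`ker_eq_span`), and coprimality of the lead monomials gives a regular sequence
(`dvd_of_mul_eq_mul`). -/

theorem sum_gammaRow_mul_gam (a b c d e : ℕ) (j : Fin 4) :
    gammaRow p M a j * gam p M b c d e - gammaRow p M b j * gam p M a c d e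
      + gammaRow p M c j * gam p M a b d e - gammaRow p M d j * gam p M a b c e
      + gammaRow p M e j * gam p M a b c d = 0 := by
  -- This is the expansion of a vanishing 5×5 determinant: rows a, …, e of Γ with column j repeated.
  fin_cases j <;>
    simp [gam, Matrix.det_succ_row_zero, Fin.sum_univ_succ, Fin.succAbove] <;> ring

/-- Frobenius is additive and fixes 𝔽_p, so a linear relation between rows of Γ becomes an additive
polynomial relation valid for every g ∈ E. -/
theorem rowComb_pow (i : Fin 2) (g : Fin 4 → ZMod p) (k : ℕ) :
    rowComb p M i g ^ p ^ k = ∑ j, ZMod.castHom (dvd_refl p) F (g j) * M i j ^ p ^ k := by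
  unfold rowComb
  rw [sum_pow_char_pow]
  refine Finset.sum_congr rfl fun j _ => ?_
  rw [mul_pow, ← map_pow, ZMod.pow_card_pow]

theorem rowComb_add (i : Fin 2) (g h : Fin 4 → ZMod p) :
    rowComb p M i (g + h) = rowComb p M i g + rowComb p M i h := by
  simp [rowComb, add_mul, Finset.sum_add_distrib]

theorem rowComb_sub (i : Fin 2) (g h : Fin 4 → ZMod p) :
    rowComb p M i (g - h) = rowComb p M i g - rowComb p M i h := by
  simp [rowComb, sub_mul, Finset.sum_sub_distrib]

/-- The coefficient of `y^p x^{p²-p}` in `f̂₁`. -/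
def coeffA : F := gam p M 1 2 4 5 / gam p M 1 2 3 4

/-- The coefficient of `δ x^{p²-2}` in `f̂₁`. -/
def coeffL : F := gam p M 1 3 4 5 / gam p M 1 2 3 4

/-- The coefficient of `y x^{p²-1}` in `f̂₁`. -/
def coeffB : F := gam p M 2 3 4 5 / gam p M 1 2 3 4

variable {p M}

/-- The dependence between rows 1 to 5 of Γ, where γ₁₂₃₅ = 0 removes row 4, that is, the term in
c₂^p. It expresses the invariance of f̂₁. -/
theorem rowComb_relation (h1234 : gam p M 1 2 3 4 ≠ 0) (h1235 : gam p M 1 2 3 5 = 0)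
    (g : Fin 4 → ZMod p) :
    rowComb p M 0 g ^ p ^ 2 + coeffA p M * rowComb p M 0 g ^ p
      - coeffL p M * rowComb p M 1 g + coeffB p M * rowComb p M 0 g = 0 := by
  have key : ∀ j, M 0 j ^ p ^ 2 + coeffA p M * M 0 j ^ p ^ 1 - coeffL p M * M 1 j
      + coeffB p M * M 0 j = 0 := by
    intro j
    have h := sum_gammaRow_mul_gam p M 1 2 3 4 5 j
    simp only [gammaRow, h1235] at h
    norm_num at h
    simp only [coeffA, coeffL, coeffB, pow_one]
    field_simp
    linear_combination h
  have e : rowComb p M 0 g ^ p = rowComb p M 0 g ^ p ^ 1 := by rw [pow_one]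
  rw [e, rowComb_pow, rowComb_pow]
  simp only [rowComb, Finset.mul_sum, ← Finset.sum_add_distrib, ← Finset.sum_sub_distrib]
  refine Finset.sum_eq_zero fun j _ => ?_
  linear_combination (ZMod.castHom (dvd_refl p) F (g j)) * key j

/-- If c₁(g) = 0, so are all its p^k-th powers; then g lies in the kernel of the matrix formed by
rows 1, 3, 5, 7 of Γ. -/
theorem rowComb_zero_injective (h1357 : gam p M 1 3 5 7 ≠ 0) :
    Function.Injective (rowComb p M 0) := by
  have key : ∀ g, rowComb p M 0 g = 0 → g = 0 := by
    intro g hg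
    have h := Matrix.eq_zero_of_mulVec_eq_zero (v := fun j => ZMod.castHom (dvd_refl p) F (g j))
      h1357 (by
        have hk : ∀ k, ∑ j, M 0 j ^ p ^ k * ZMod.castHom (dvd_refl p) F (g j) = 0 := by
          intro k
          have := rowComb_pow p M 0 g k
          rw [hg, zero_pow (pow_ne_zero _ (Fact.out : p.Prime).ne_zero)] at this
          rw [this]
          exact Finset.sum_congr rfl fun j _ => mul_comm _ _
        ext i
        fin_cases i
        · simpa [Matrix.mulVec, dotProduct, gammaRow] using hk 0
        · simpa [Matrix.mulVec, dotProduct, gammaRow] using hk 1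
        · simpa [Matrix.mulVec, dotProduct, gammaRow] using hk 2
        · simpa [Matrix.mulVec, dotProduct, gammaRow] using hk 3)
    ext j
    have hj : ZMod.castHom (dvd_refl p) F (g j) = 0 := congrFun h j
    exact (map_eq_zero _).mp hj
  intro g h hgh
  exact sub_eq_zero.mp (key _ (by rw [rowComb_sub, hgh, sub_self]))

/-- Without its c₂ term, `rowComb_relation` would be a dependence between rows 1, 3, 5 of Γ,
contradicting γ₁₃₅₇ ≠ 0. -/
theorem coeffL_ne_zero (h1234 : gam p M 1 2 3 4 ≠ 0) (h1235 : gam p M 1 2 3 5 = 0)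
    (h1357 : gam p M 1 3 5 7 ≠ 0) : coeffL p M ≠ 0 := by
  intro hL
  have hroot : ∀ g, rowComb p M 0 g ^ p ^ 2 + coeffA p M * rowComb p M 0 g ^ p
      + coeffB p M * rowComb p M 0 g = 0 := by
    intro g
    have := rowComb_relation h1234 h1235 g
    rw [hL] at this
    linear_combination this
  have h := Matrix.eq_zero_of_vecMul_eq_zero (v := ![coeffB p M, coeffA p M, 1, 0]) h1357 (by
    ext j
    have hj := hroot (Pi.single j 1)
    have hm : rowComb p M 0 (Pi.single j 1) = M 0 j := by
      simp [rowComb, Pi.single_apply]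
    rw [hm] at hj
    simp only [Matrix.vecMul, dotProduct, Fin.sum_univ_four]
    simp [gammaRow]
    linear_combination hj)
  have := congrFun h 2
  simp at this

/-- The coefficients of the additive polynomial vanishing on the entries of the first row of `M`. -/
theorem exists_rowComb_relation (h1357 : gam p M 1 3 5 7 ≠ 0) :
    ∃ d₂ d₃ d₄ : F, ∀ g : Fin 4 → ZMod p,
      rowComb p M 0 g ^ p ^ 4 + -(gam p M 1 3 5 9 / gam p M 1 3 5 7) * rowComb p M 0 g ^ p ^ 3
        + d₂ * rowComb p M 0 g ^ p ^ 2 + d₃ * rowComb p M 0 g ^ p ^ 1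
        + d₄ * rowComb p M 0 g = 0 := by
  refine ⟨gam p M 1 3 7 9 / gam p M 1 3 5 7, -(gam p M 1 5 7 9 / gam p M 1 3 5 7),
    gam p M 3 5 7 9 / gam p M 1 3 5 7, fun g => ?_⟩
  rw [rowComb_pow, rowComb_pow, rowComb_pow, rowComb_pow]
  simp only [rowComb, Finset.mul_sum, ← Finset.sum_add_distrib]
  refine Finset.sum_eq_zero fun j _ => ?_
  have h := sum_gammaRow_mul_gam p M 1 3 5 7 9 j
  simp only [gammaRow] at h
  norm_num at h
  field_simp
  linear_combination (ZMod.castHom (dvd_refl p) F (g j)) * h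

/-! ### The action on the variables -/

theorem act_X_two (g : E p) : act p M g (X 2) = X 2 := (matrixAct_sigma _ _).1

theorem act_X_one (g : E p) :
    act p M g (X 1) = X 1 + C (rowComb p M 0 g.toAdd) * X 2 := (matrixAct_sigma _ _).2.1

theorem act_X_zero (g : E p) :
    act p M g (X 0) = X 0 + C (2 * rowComb p M 0 g.toAdd) * X 1
      + C (rowComb p M 0 g.toAdd ^ 2 + rowComb p M 1 g.toAdd) * X 2 := (matrixAct_sigma _ _).2.2

theorem act_C (g : E p) (c : F) : act p M g (C c) = C c := (act p M g).commutes c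

theorem act_delta (g : E p) :
    act p M g delta = delta - C (rowComb p M 1 g.toAdd) * X 2 ^ 2 := by
  simp only [delta, map_sub, map_mul, map_pow, act_X_two, act_X_one, act_X_zero, map_add,
    map_ofNat]
  ring

theorem act_mul (g h : E p) (f : MvPolynomial (Fin 3) F) :
    act p M (g * h) f = act p M h (act p M g f) := by
  have : act p M (g * h) = (act p M h).comp (act p M g) := by
    apply MvPolynomial.algHom_ext
    intro i
    fin_cases i
    · simp only [Fin.zero_eta, AlgHom.comp_apply, act_X_zero, act_X_one, act_X_two, map_add,
        map_mul, act_C, toAdd_mul, rowComb_add, map_pow, map_ofNat]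
      ring
    · simp only [Fin.mk_one, AlgHom.comp_apply, act_X_one, act_X_two, map_add,
        map_mul, act_C, toAdd_mul, rowComb_add]
      ring
    · simp only [Fin.reduceFinMk, AlgHom.comp_apply, act_X_two]
  rw [this, AlgHom.comp_apply]

theorem act_X_one_injective (h1357 : gam p M 1 3 5 7 ≠ 0) :
    Function.Injective fun g : E p => act p M g (X 1) := by
  intro g h hgh
  simp only [act_X_one, add_right_inj] at hgh
  have := C_injective _ _ (mul_right_cancel₀ (X_ne_zero (2 : Fin 3)) hgh)
  exact rowComb_zero_injective h1357 this

theorem act_X_zero_injective (hp : 2 < p) (h1357 : gam p M 1 3 5 7 ≠ 0) :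
    Function.Injective fun g : E p => act p M g (X 0) := by
  intro g h hgh
  -- The coefficient of y in z · g is 2c₁(g), and 2 is invertible.
  have := congrArg (coeff (Finsupp.single 1 1)) hgh
  have h2 : (2 : F) ≠ 0 := by
    intro h2
    have := (CharP.cast_eq_zero_iff F p 2).mp (by exact_mod_cast h2)
    exact absurd (Nat.le_of_dvd (by norm_num) this) (by omega)
  simp only [act_X_zero, coeff_add, coeff_C_mul, coeff_X] at this
  simp [Finsupp.single_left_inj, h2] at this
  exact rowComb_zero_injective h1357 this

theorem orbitNorm_eq_prod (f : MvPolynomial (Fin 3) F)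
    (hf : Function.Injective fun g : E p => act p M g f) :
    orbitNorm p M f = ∏ g : E p, act p M g f := by
  classical
  rw [orbitNorm, Finset.prod_image (fun _ _ _ _ h => hf h)]

theorem orbitNorm_mem_invariants (f : MvPolynomial (Fin 3) F)
    (hf : Function.Injective fun g : E p => act p M g f) :
    orbitNorm p M f ∈ invariants p M := by
  intro h
  rw [orbitNorm_eq_prod f hf, map_prod]
  simp_rw [← act_mul]
  exact Fintype.prod_equiv (Equiv.mulRight h) _ _ fun g => rfl

theorem card_E : Fintype.card (E p) = p ^ 4 := by
  rw [Fintype.card_multiplicative, Fintype.card_fun, ZMod.card, Fintype.card_fin]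

theorem fHat₁_eq : fHat₁ p M = X 1 ^ p ^ 2 + C (coeffA p M) * X 1 ^ p * X 2 ^ (p ^ 2 - p)
    + C (coeffL p M) * delta * X 2 ^ (p ^ 2 - 2) + C (coeffB p M) * X 1 * X 2 ^ (p ^ 2 - 1) := rfl

theorem fHat₁_mem_invariants (h1234 : gam p M 1 2 3 4 ≠ 0) (h1235 : gam p M 1 2 3 5 = 0) :
    fHat₁ p M ∈ invariants p M := by
  intro g
  have hrel := congrArg (C (σ := Fin 3)) (rowComb_relation h1234 h1235 g.toAdd)
  simp only [map_add, map_sub, map_mul, map_pow, map_zero] at hrel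
  have hp2 : 2 ≤ p := (Fact.out : p.Prime).two_le
  have e1 : p ^ 2 = (p ^ 2 - p) + p := by nlinarith [Nat.sub_add_cancel (show p ≤ p ^ 2 by nlinarith)]
  have e2 : p ^ 2 = (p ^ 2 - 2) + 2 := by nlinarith [Nat.sub_add_cancel (show 2 ≤ p ^ 2 by nlinarith)]
  have e3 : p ^ 2 = (p ^ 2 - 1) + 1 := by nlinarith [Nat.sub_add_cancel (show 1 ≤ p ^ 2 by nlinarith)]
  have x1 : (X 2 : MvPolynomial (Fin 3) F) ^ p ^ 2 = X 2 ^ (p ^ 2 - p) * X 2 ^ p := by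
    rw [← pow_add, ← e1]
  have x2 : (X 2 : MvPolynomial (Fin 3) F) ^ p ^ 2 = X 2 ^ (p ^ 2 - 2) * X 2 ^ 2 := by
    rw [← pow_add, ← e2]
  have x3 : (X 2 : MvPolynomial (Fin 3) F) ^ p ^ 2 = X 2 ^ (p ^ 2 - 1) * X 2 := by
    rw [← pow_succ, ← e3]
  simp only [fHat₁_eq, map_add, map_mul, map_pow, act_C, act_X_one, act_X_two, act_delta,
    add_pow_char_pow, add_pow_char, mul_pow]
  -- The change of f̂₁ under g is x^{p²} times the additive relation; `x1`, `x2`, `x3` merge the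
  -- powers of x.
  linear_combination X 2 ^ p ^ 2 * hrel
    - C (coeffA p M) * C (rowComb p M 0 g.toAdd) ^ p * x1
    + C (coeffL p M) * C (rowComb p M 1 g.toAdd) * x2
    - C (coeffB p M) * C (rowComb p M 0 g.toAdd) * x3

/-! ### Explicit descriptions of `N_M(y)`, `h₂` and `h₃` -/

/-- Both sides are values at y of monic polynomials of degree p⁴ that vanish at the p⁴ distinct
points c₁(g)x, so they agree. Only the coefficient of y^{p³} is made explicit, since only that one
is cancelled in h̃₂. -/
theorem orbitNorm_X_one (h1357 : gam p M 1 3 5 7 ≠ 0) :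
    ∃ d₂ d₃ d₄ : F, orbitNorm p M (X 1) = X 1 ^ p ^ 4
      - C (gam p M 1 3 5 9 / gam p M 1 3 5 7) * X 2 ^ (p ^ 4 - p ^ 3) * X 1 ^ p ^ 3
      + C d₂ * X 2 ^ (p ^ 4 - p ^ 2) * X 1 ^ p ^ 2 + C d₃ * X 2 ^ (p ^ 4 - p) * X 1 ^ p
      + C d₄ * X 2 ^ (p ^ 4 - 1) * X 1 := by
  obtain ⟨d₂, d₃, d₄, hd⟩ := exists_rowComb_relation h1357
  refine ⟨d₂, d₃, d₄, ?_⟩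
  have hp : 1 < p := (Fact.out : p.Prime).one_lt
  have l4 : p ^ 3 < p ^ 4 := Nat.pow_lt_pow_right hp (by norm_num)
  have l3 : p ^ 2 < p ^ 4 := Nat.pow_lt_pow_right hp (by norm_num)
  have l2 : p < p ^ 4 := lt_self_pow₀ hp (by norm_num)
  have l1 : 1 < p ^ 4 := hp.trans l2
  let R := MvPolynomial (Fin 3) F
  let a : E p → R := fun g => C (rowComb p M 0 g.toAdd) * X 2
  have ha : Function.Injective a := fun g h hgh =>
    rowComb_zero_injective h1357 (C_injective _ _ (mul_right_cancel₀ (X_ne_zero (2 : Fin 3)) hgh))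
  let B : Polynomial R := - Polynomial.C (C (gam p M 1 3 5 9 / gam p M 1 3 5 7)
        * X 2 ^ (p ^ 4 - p ^ 3)) * Polynomial.X ^ p ^ 3
    + Polynomial.C (C d₂ * X 2 ^ (p ^ 4 - p ^ 2)) * Polynomial.X ^ p ^ 2
    + Polynomial.C (C d₃ * X 2 ^ (p ^ 4 - p)) * Polynomial.X ^ p
    + Polynomial.C (C d₄ * X 2 ^ (p ^ 4 - 1)) * Polynomial.X
  have hB : B.degree < ((p ^ 4 : ℕ) : WithBot ℕ) := by
    have aux : ∀ (c : R) (k : ℕ), k < p ^ 4 →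
        (Polynomial.C c * Polynomial.X ^ k).degree < ((p ^ 4 : ℕ) : WithBot ℕ) := fun c k hk =>
      (Polynomial.degree_C_mul_X_pow_le _ _).trans_lt (by exact_mod_cast hk)
    refine (Polynomial.degree_add_le _ _).trans_lt (max_lt
      ((Polynomial.degree_add_le _ _).trans_lt (max_lt
      ((Polynomial.degree_add_le _ _).trans_lt (max_lt ?_ ?_)) ?_)) ?_)
    · rw [← Polynomial.C_neg]; exact aux _ _ l4
    · exact aux _ _ l3
    · exact aux _ _ l2
    · have h := aux (C d₄ * X 2 ^ (p ^ 4 - 1)) 1 l1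
      rwa [pow_one] at h
  let P : Polynomial R := ∏ g : E p, (Polynomial.X - Polynomial.C (a g))
  have hPm : P.Monic := Polynomial.monic_prod_X_sub_C _ _
  have hPd : P.degree = ((p ^ 4 : ℕ) : WithBot ℕ) := by
    rw [Polynomial.degree_prod]
    simp only [Polynomial.degree_X_sub_C, Finset.sum_const, Finset.card_univ, card_E]
    simp
  have hQm : (Polynomial.X ^ p ^ 4 + B).Monic := Polynomial.monic_X_pow_add hB
  have hQd : (Polynomial.X ^ p ^ 4 + B).degree = ((p ^ 4 : ℕ) : WithBot ℕ) := by
    rw [Polynomial.degree_add_eq_left_of_degree_lt] <;> rw [Polynomial.degree_X_pow]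
    exact hB
  have hPQ : P = Polynomial.X ^ p ^ 4 + B := by
    refine Polynomial.eq_of_degree_sub_lt_of_eval_index_eq (Finset.univ) (v := a) ha.injOn ?_ ?_
    · rw [Finset.card_univ, card_E, ← hPd]
      exact Polynomial.degree_sub_lt_left (hPd.trans hQd.symm) hPm.ne_zero
        (hPm.leadingCoeff.trans hQm.leadingCoeff.symm)
    · intro g _
      have h0 : P.eval (a g) = 0 := by
        rw [Polynomial.eval_prod]
        exact Finset.prod_eq_zero (Finset.mem_univ g) (by simp)
      have hrel := congrArg (C (σ := Fin 3)) (hd g.toAdd)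
      simp only [map_add, map_neg, map_mul, map_pow, map_zero, pow_one] at hrel
      have x1 : ∀ k, k ≤ p ^ 4 → (X 2 : R) ^ (p ^ 4 - k) * X 2 ^ k = X 2 ^ p ^ 4 := fun k hk => by
        rw [← pow_add, Nat.sub_add_cancel hk]
      have y1 := x1 _ l4.le
      have y2 := x1 _ l3.le
      have y3 := x1 _ l2.le
      have y4 := x1 _ l1.le
      rw [h0]
      simp only [B, a, Polynomial.eval_add, Polynomial.eval_mul, Polynomial.eval_neg,
        Polynomial.eval_C, Polynomial.eval_pow, Polynomial.eval_X, mul_pow]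
      rw [pow_one] at y4
      linear_combination - X 2 ^ p ^ 4 * hrel
        + C (gam p M 1 3 5 9 / gam p M 1 3 5 7) * C (rowComb p M 0 g.toAdd) ^ p ^ 3 * y1
        - C d₂ * C (rowComb p M 0 g.toAdd) ^ p ^ 2 * y2
        - C d₃ * C (rowComb p M 0 g.toAdd) ^ p * y3
        - C d₄ * C (rowComb p M 0 g.toAdd) * y4
  have hN : orbitNorm p M (X 1) = P.eval (X 1) := by
    rw [orbitNorm_eq_prod _ (act_X_one_injective h1357), Polynomial.eval_prod]
    -- The roots enter as y − c₁(g)x and the orbit as y + c₁(g)x; inversion in E matches them.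
    refine Fintype.prod_equiv (Equiv.inv (E p)) _ _ fun g => ?_
    have : rowComb p M 0 (-g.toAdd) = - rowComb p M 0 g.toAdd := by
      rw [← zero_sub, rowComb_sub]; simp [rowComb]
    simp [a, act_X_one, this]
  rw [hN, hPQ]
  simp only [B, Polynomial.eval_add, Polynomial.eval_mul, Polynomial.eval_neg,
        Polynomial.eval_C, Polynomial.eval_pow, Polynomial.eval_X]
  ring

variable (p M) in
/-- The cofactor of `x^{p²-p}` in `f̂₁ - y^{p²}`. -/
def fTail : MvPolynomial (Fin 3) F :=
  C (coeffA p M) * X 1 ^ p + C (coeffL p M) * delta * X 2 ^ (p - 2)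
    + C (coeffB p M) * X 1 * X 2 ^ (p - 1)

theorem fHat₁_eq_add (hp : 2 < p) :
    fHat₁ p M = X 1 ^ p ^ 2 + X 2 ^ (p ^ 2 - p) * fTail p M := by
  obtain ⟨n, rfl⟩ : ∃ n, p = n + 3 := ⟨p - 3, by omega⟩
  have e1 : (n + 3) ^ 2 - (n + 3) = n ^ 2 + 5 * n + 6 := Nat.sub_eq_of_eq_add (by ring)
  have e2 : (n + 3) ^ 2 - 2 = n ^ 2 + 6 * n + 7 := Nat.sub_eq_of_eq_add (by ring)
  have e3 : (n + 3) ^ 2 - 1 = n ^ 2 + 6 * n + 8 := Nat.sub_eq_of_eq_add (by ring)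
  have e4 : n + 3 - 2 = n + 1 := by omega
  have e5 : n + 3 - 1 = n + 2 := by omega
  rw [fHat₁_eq, fTail, e1, e2, e3, e4, e5]
  ring

/-- The powers f̂₁^{p²} and f̂₁^p are computed by Frobenius. The terms in y^{p⁴}, y^{p³} and y^{2p²}
cancel against N_M(y) and the two corrections. What survives with the lowest power of x is the cross
term 2y^{p²}x^{p²-p}·`fTail` of f̂₁². -/
theorem exists_hTilde₂_eq (hp : 2 < p) (h1234 : gam p M 1 2 3 4 ≠ 0)
    (h1357 : gam p M 1 3 5 7 ≠ 0) :
    ∃ w, hTilde₂ p M = X 2 ^ (p ^ 4 - p ^ 2 - p) *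
      (C (2 * coeffL p M ^ p ^ 2 * coeffA p M) * X 1 ^ (p ^ 2 + p)
        + C (2 * coeffL p M ^ p ^ 2 * coeffL p M) * X 1 ^ p ^ 2 * delta * X 2 ^ (p - 2)
        + X 2 ^ (p - 1) * w) := by
  obtain ⟨d₂, d₃, d₄, hN⟩ := orbitNorm_X_one h1357
  have hL : gam p M 1 3 4 5 ^ p ^ 2 / gam p M 1 2 3 4 ^ p ^ 2 = coeffL p M ^ p ^ 2 := by
    rw [coeffL, div_pow]
  have hA : gam p M 1 2 4 5 ^ p ^ 2 / gam p M 1 2 3 4 ^ p ^ 2 = coeffA p M ^ p ^ 2 := by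
    rw [coeffA, div_pow]
  generalize hd1 : gam p M 1 3 5 9 / gam p M 1 3 5 7 = d₁ at hN
  have hF2 : fHat₁ p M ^ p ^ 2 = X 1 ^ (p ^ 2 * p ^ 2)
      + C (coeffA p M) ^ p ^ 2 * X 1 ^ (p * p ^ 2) * X 2 ^ ((p ^ 2 - p) * p ^ 2)
      + C (coeffL p M) ^ p ^ 2 * (X 1 ^ (2 * p ^ 2) - X 2 ^ p ^ 2 * X 0 ^ p ^ 2)
        * X 2 ^ ((p ^ 2 - 2) * p ^ 2)
      + C (coeffB p M) ^ p ^ 2 * X 1 ^ p ^ 2 * X 2 ^ ((p ^ 2 - 1) * p ^ 2) := by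
    simp only [fHat₁_eq, delta, add_pow_char_pow, sub_pow_char_pow, mul_pow, ← pow_mul]
  have hF1 : fHat₁ p M ^ p = X 1 ^ (p ^ 2 * p)
      + C (coeffA p M) ^ p * X 1 ^ (p * p) * X 2 ^ ((p ^ 2 - p) * p)
      + C (coeffL p M) ^ p * delta ^ p * X 2 ^ ((p ^ 2 - 2) * p)
      + C (coeffB p M) ^ p * X 1 ^ p * X 2 ^ ((p ^ 2 - 1) * p) := by
    simp only [fHat₁_eq, add_pow_char, mul_pow, ← pow_mul]
  rw [hTilde₂, hd1, hL, hA, hN, hF2, hF1, fHat₁_eq_add hp, fTail]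
  generalize coeffA p M = α
  generalize coeffL p M = l
  generalize coeffB p M = β
  -- With p = n + 3 the truncated differences in the exponents become polynomials in n, which `ring`
  -- can compare.
  obtain ⟨n, rfl⟩ : ∃ n, p = n + 3 := ⟨p - 3, by omega⟩
  have e1 : (n + 3) ^ 2 - (n + 3) = n ^ 2 + 5 * n + 6 := Nat.sub_eq_of_eq_add (by ring)
  have e2 : (n + 3) ^ 2 - 2 = n ^ 2 + 6 * n + 7 := Nat.sub_eq_of_eq_add (by ring)
  have e3 : (n + 3) ^ 2 - 1 = n ^ 2 + 6 * n + 8 := Nat.sub_eq_of_eq_add (by ring)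
  have e4 : n + 3 - 2 = n + 1 := by omega
  have e5 : n + 3 - 1 = n + 2 := by omega
  have e6 : (n + 3) ^ 4 - (n + 3) ^ 3 = (n + 3) ^ 3 * (n + 2) := Nat.sub_eq_of_eq_add (by ring)
  have e7 : (n + 3) ^ 4 - (n + 3) ^ 2 = (n + 3) ^ 2 * (n ^ 2 + 6 * n + 8) :=
    Nat.sub_eq_of_eq_add (by ring)
  have e8 : (n + 3) ^ 4 - (n + 3) = (n + 3) * (n + 2) * (n ^ 2 + 7 * n + 13) :=
    Nat.sub_eq_of_eq_add (by ring)
  have e9 : (n + 3) ^ 4 - 1 = n ^ 4 + 12 * n ^ 3 + 54 * n ^ 2 + 108 * n + 80 :=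
    Nat.sub_eq_of_eq_add (by ring)
  have e10 : (n + 3) ^ 4 - 2 * (n + 3) ^ 2 = (n + 3) ^ 2 * (n ^ 2 + 6 * n + 7) :=
    Nat.sub_eq_of_eq_add (by ring)
  have e11 : (n + 3) ^ 2 * (n ^ 2 + 6 * n + 8) - (n + 3) =
      n ^ 4 + 12 * n ^ 3 + 53 * n ^ 2 + 101 * n + 69 :=
    Nat.sub_eq_of_eq_add (by ring)
  rw [e6, e7, e8, e9, e10, e11, e1, e2, e3, e4, e5]
  let u : MvPolynomial (Fin 3) F := C α * X 1 ^ (n + 3) + C l * delta * X 2 ^ (n + 1)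
    + C β * X 1 * X 2 ^ (n + 2)
  -- The leftovers: the β part of the cross term, the squared tail, the z^{p²} part of δ^{p²}, the
  -- tail of f̂₁^p, and the lower terms of N_M(y) and f̂₁^{p²}.
  refine ⟨C (l ^ (n + 3) ^ 2) * (2 * C β * X 1 ^ ((n + 3) ^ 2 + 1)
      + X 2 ^ (n ^ 2 + 4 * n + 4) * u ^ 2 + X 2 * X 0 ^ (n + 3) ^ 2)
    + C (d₁ + α ^ (n + 3) ^ 2) * (C α ^ (n + 3) * X 1 ^ (n + 3) ^ 2 * X 2
      + C l ^ (n + 3) * delta ^ (n + 3) * X 2 ^ (n ^ 2 + 4 * n + 4)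
      + C β ^ (n + 3) * X 1 ^ (n + 3) * X 2 ^ (n ^ 2 + 5 * n + 7))
    + C (d₂ - β ^ (n + 3) ^ 2) * X 1 ^ (n + 3) ^ 2 * X 2
    + C d₃ * X 1 ^ (n + 3) * X 2 ^ (n ^ 2 + 5 * n + 7)
    + C d₄ * X 1 * X 2 ^ (n ^ 2 + 6 * n + 9), ?_⟩
  simp only [u, map_add, map_mul, map_sub, map_pow, map_ofNat]
  generalize (delta : MvPolynomial (Fin 3) F) = δ
  ring

theorem two_ne_zero_of_charP (hp : 2 < p) (F : Type*) [Field F] [CharP F p] : (2 : F) ≠ 0 := by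
  intro h2
  have := (CharP.cast_eq_zero_iff F p 2).mp (by exact_mod_cast h2)
  exact absurd (Nat.le_of_dvd (by norm_num) this) (by omega)

theorem X_pow_mul_divMonomial (i : Fin 3) (k : ℕ) (f : MvPolynomial (Fin 3) F) :
    (X i ^ k * f).divMonomial (Finsupp.single i k) = f := by
  rw [X_pow_eq_monomial, divMonomial_monomial_mul]

theorem coeffA_ne_zero (h1234 : gam p M 1 2 3 4 ≠ 0) (h1245 : gam p M 1 2 4 5 ≠ 0) :
    coeffA p M ≠ 0 := div_ne_zero h1245 h1234

variable (p M) in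
/-- The quotient `γ₁₃₄₅ / γ₁₂₄₅`. -/
def coeffMu : F := coeffL p M / coeffA p M

theorem coeffMu_eq (h1234 : gam p M 1 2 3 4 ≠ 0) :
    coeffMu p M = gam p M 1 3 4 5 / gam p M 1 2 4 5 := by
  rw [coeffMu, coeffL, coeffA]
  field_simp

/-- The term of order p − 2 in x is kept because h₃ arises from it: its p-th power is what the
correction in h̃₃ meets, and its product with the lead term of h₂ is what survives there. -/
theorem exists_h₂_eq (hp : 2 < p) (h1234 : gam p M 1 2 3 4 ≠ 0) (h1235 : gam p M 1 2 3 5 = 0)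
    (h1357 : gam p M 1 3 5 7 ≠ 0) (h1245 : gam p M 1 2 4 5 ≠ 0) :
    (∃ w, h₂ p M = X 1 ^ (p ^ 2 + p)
        + C (coeffMu p M) * X 1 ^ p ^ 2 * delta * X 2 ^ (p - 2) + X 2 ^ (p - 1) * w) ∧
      hTilde₂ p M = C (2 * coeffL p M ^ p ^ 2 * coeffA p M) * X 2 ^ (p ^ 4 - p ^ 2 - p)
        * h₂ p M := by
  obtain ⟨w, hw⟩ := exists_hTilde₂_eq hp h1234 h1357
  have h2 := two_ne_zero_of_charP hp F
  have hA := coeffA_ne_zero h1234 h1245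
  have hL := coeffL_ne_zero h1234 h1235 h1357
  have hc0 : 2 * coeffL p M ^ p ^ 2 * coeffA p M ≠ 0 :=
    mul_ne_zero (mul_ne_zero h2 (pow_ne_zero _ hL)) hA
  have hc : gam p M 1 2 3 4 ^ (p ^ 2 + 1) / (2 * gam p M 1 3 4 5 ^ p ^ 2 * gam p M 1 2 4 5)
      = (2 * coeffL p M ^ p ^ 2 * coeffA p M)⁻¹ := by
    rw [coeffL, coeffA, div_pow, pow_succ]
    field_simp
  have e1 : (2 * coeffL p M ^ p ^ 2 * coeffA p M)⁻¹ * (2 * coeffL p M ^ p ^ 2 * coeffA p M) = 1 :=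
    inv_mul_cancel₀ hc0
  have e2 : (2 * coeffL p M ^ p ^ 2 * coeffA p M)⁻¹ * (2 * coeffL p M ^ p ^ 2 * coeffL p M)
      = coeffMu p M := by
    rw [coeffMu]; field_simp
  have e1' := congrArg (C (σ := Fin 3)) e1
  have e2' := congrArg (C (σ := Fin 3)) e2
  rw [map_mul, map_one] at e1'
  rw [map_mul] at e2'
  constructor
  · refine ⟨C (2 * coeffL p M ^ p ^ 2 * coeffA p M)⁻¹ * w, ?_⟩
    rw [h₂, hw, X_pow_mul_divMonomial, hc]
    linear_combination X 1 ^ (p ^ 2 + p) * e1' + X 1 ^ p ^ 2 * delta * X 2 ^ (p - 2) * e2'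
  · rw [h₂, hw, X_pow_mul_divMonomial, hc]
    linear_combination - X 2 ^ (p ^ 4 - p ^ 2 - p) *
      (C (2 * coeffL p M ^ p ^ 2 * coeffA p M) * X 1 ^ (p ^ 2 + p)
        + C (2 * coeffL p M ^ p ^ 2 * coeffL p M) * X 1 ^ p ^ 2 * delta * X 2 ^ (p - 2)
        + X 2 ^ (p - 1) * w) * e1'

/-- The lead terms of f̂₁^{p+1} and h₂^p cancel. The next term −μ^p y^{p³+2p} x^{p²-2p} of −h₂^p is
cancelled by the correction, whose factor h₂² contributes the surviving cross term 2μ y^{2p²+p} δ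
x^{p-2}. -/
theorem exists_hTilde₃_eq (hp : 2 < p) (h1234 : gam p M 1 2 3 4 ≠ 0)
    (h1235 : gam p M 1 2 3 5 = 0)
    (h1357 : gam p M 1 3 5 7 ≠ 0) (h1245 : gam p M 1 2 4 5 ≠ 0) :
    ∃ w : MvPolynomial (Fin 3) F, hTilde₃ p M = X 2 ^ (p ^ 2 - p - 2) *
      (C (2 * coeffMu p M ^ (p + 1)) * (X 1 ^ (p ^ 3 + p) * delta) + X 2 * w) := by
  obtain ⟨⟨w, hw⟩, -⟩ := exists_h₂_eq hp h1234 h1235 h1357 h1245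
  obtain ⟨v, hv⟩ : ∃ v : MvPolynomial (Fin 3) F, fHat₁ p M ^ (p - 2) = X 1 ^ (p ^ 2 * (p - 2))
      + X 2 ^ (p ^ 2 - p) * v := by
    have h := sub_dvd_pow_sub_pow (fHat₁ p M) (X 1 ^ p ^ 2) (p - 2)
    obtain ⟨c, hc⟩ := h
    refine ⟨fTail p M * c, ?_⟩
    have hf := fHat₁_eq_add (M := M) hp
    rw [pow_mul]
    linear_combination hc + c * hf
  have hF : fHat₁ p M ^ (p + 1) = (X 1 ^ (p ^ 2 * p) + X 2 ^ ((p ^ 2 - p) * p) * fTail p M ^ p)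
      * (X 1 ^ p ^ 2 + X 2 ^ (p ^ 2 - p) * fTail p M) := by
    rw [pow_succ, fHat₁_eq_add hp, add_pow_char, mul_pow, ← pow_mul, ← pow_mul]
  have hH : h₂ p M ^ p = X 1 ^ ((p ^ 2 + p) * p)
      + C (coeffMu p M) ^ p * X 1 ^ (p ^ 2 * p) * (X 1 ^ (2 * p) - X 2 ^ p * X 0 ^ p)
        * X 2 ^ ((p - 2) * p)
      + X 2 ^ ((p - 1) * p) * w ^ p := by
    rw [hw, add_pow_char, add_pow_char]
    simp only [delta, mul_pow, sub_pow_char, ← pow_mul]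
  rw [hTilde₃, ← coeffMu_eq h1234, hv, hF, hH, hw]
  generalize coeffMu p M = μ
  generalize fTail p M = u
  obtain ⟨n, rfl⟩ : ∃ n, p = n + 3 := ⟨p - 3, by omega⟩
  have e1 : (n + 3) ^ 2 - (n + 3) = n ^ 2 + 5 * n + 6 := Nat.sub_eq_of_eq_add (by ring)
  have e2 : n ^ 2 + 5 * n + 6 - 2 = n ^ 2 + 5 * n + 4 := by omega
  have e3 : (n + 3) ^ 2 - 2 * (n + 3) = n ^ 2 + 4 * n + 3 := Nat.sub_eq_of_eq_add (by ring)
  have e4 : n + 3 - 2 = n + 1 := by omega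
  have e5 : n + 3 - 1 = n + 2 := by omega
  rw [e1, e2, e3, e4, e5]
  refine ⟨X 2 * (X 1 ^ ((n + 3) ^ 2 * (n + 3)) * u
        + X 2 ^ ((n ^ 2 + 5 * n + 6) * (n + 2)) * u ^ (n + 3)
          * (X 1 ^ (n + 3) ^ 2 + X 2 ^ (n ^ 2 + 5 * n + 6) * u)
      + C μ ^ (n + 3) * X 1 ^ ((n + 3) ^ 2 * (n + 3)) * X 0 ^ (n + 3) - w ^ (n + 3))
    + C μ ^ (n + 3) * (X 2 ^ (n ^ 2 + 4 * n + 4) * v * (X 1 ^ ((n + 3) ^ 2 + (n + 3))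
      + C μ * X 1 ^ (n + 3) ^ 2 * delta * X 2 ^ (n + 1) + X 2 ^ (n + 2) * w) ^ 2
      + X 1 ^ ((n + 3) ^ 2 * (n + 1)) * (2 * X 1 ^ ((n + 3) ^ 2 + (n + 3)) * w
        + X 2 ^ n * (C μ * X 1 ^ (n + 3) ^ 2 * delta + X 2 * w) ^ 2)), ?_⟩
  simp only [map_mul, map_pow, map_ofNat]
  generalize (delta : MvPolynomial (Fin 3) F) = δ
  ring

theorem exists_h₃_eq (hp : 2 < p) (h1234 : gam p M 1 2 3 4 ≠ 0) (h1235 : gam p M 1 2 3 5 = 0)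
    (h1357 : gam p M 1 3 5 7 ≠ 0) (h1245 : gam p M 1 2 4 5 ≠ 0) :
    (∃ w : MvPolynomial (Fin 3) F, h₃ p M = X 1 ^ (p ^ 3 + p) * delta + X 2 * w) ∧
      hTilde₃ p M = C (2 * coeffMu p M ^ (p + 1)) * X 2 ^ (p ^ 2 - p - 2) * h₃ p M := by
  obtain ⟨w, hw⟩ := exists_hTilde₃_eq hp h1234 h1235 h1357 h1245
  have h2 := two_ne_zero_of_charP hp F
  have hμ : coeffMu p M ≠ 0 :=
    div_ne_zero (coeffL_ne_zero h1234 h1235 h1357) (coeffA_ne_zero h1234 h1245)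
  have hc0 : 2 * coeffMu p M ^ (p + 1) ≠ 0 := mul_ne_zero h2 (pow_ne_zero _ hμ)
  have hc : gam p M 1 2 4 5 ^ (p + 1) / (2 * gam p M 1 3 4 5 ^ (p + 1))
      = (2 * coeffMu p M ^ (p + 1))⁻¹ := by
    rw [coeffMu_eq h1234, div_pow, mul_inv, inv_div]
    field_simp
  have e1 := congrArg (C (σ := Fin 3)) (inv_mul_cancel₀ hc0)
  rw [map_mul, map_one] at e1
  constructor
  · refine ⟨C (2 * coeffMu p M ^ (p + 1))⁻¹ * w, ?_⟩
    rw [h₃, hw, X_pow_mul_divMonomial, hc]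
    linear_combination X 1 ^ (p ^ 3 + p) * delta * e1
  · rw [h₃, hw, X_pow_mul_divMonomial, hc]
    linear_combination - X 2 ^ (p ^ 2 - p - 2) *
      (C (2 * coeffMu p M ^ (p + 1)) * (X 1 ^ (p ^ 3 + p) * delta) + X 2 * w) * e1

/-! ### Invariance and homogeneity of the generators -/

/-- This passes invariance from h̃₂ and h̃₃ to their quotients by powers of x. -/
theorem mem_invariants_of_mul {a b : MvPolynomial (Fin 3) F} (ha : a ∈ invariants p M)
    (ha0 : a ≠ 0) (hab : a * b ∈ invariants p M) : b ∈ invariants p M := by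
  intro g
  have := hab g
  rw [map_mul, ha g] at this
  exact mul_left_cancel₀ ha0 this

theorem isHomogeneous_of_X_pow_mul {i : Fin 3} {b : MvPolynomial (Fin 3) F} {m n : ℕ}
    (hab : (X i ^ m * b).IsHomogeneous (m + n)) : b.IsHomogeneous n := by
  rw [X_pow_eq_monomial] at hab
  intro d hd
  have h := hab (d := Finsupp.single i m + d) (by rwa [coeff_monomial_mul, one_mul])
  simp only [map_add, Finsupp.weight_single, Pi.one_apply, smul_eq_mul, mul_one] at h
  omega

theorem isHomogeneous_of_C_mul_X_pow_mul {i : Fin 3} {b : MvPolynomial (Fin 3) F} {c : F}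
    {m n : ℕ} (hc : c ≠ 0)
    (hab : (C c * X i ^ m * b).IsHomogeneous (m + n)) : b.IsHomogeneous n := by
  refine isHomogeneous_of_X_pow_mul (i := i) (m := m) ?_
  have h := hab.C_mul c⁻¹
  rwa [← mul_assoc, ← mul_assoc, ← map_mul, inv_mul_cancel₀ hc, map_one, one_mul] at h

theorem isHomogeneous_of_degree_eq {σ : Type*} {f : MvPolynomial σ F} {m n : ℕ}
    (hf : f.IsHomogeneous m) (h : m = n) : f.IsHomogeneous n := h ▸ hf

theorem act_isHomogeneous (g : E p) {f : MvPolynomial (Fin 3) F} {n : ℕ} (hf : f.IsHomogeneous n) :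
    (act p M g f).IsHomogeneous n := by
  have := hf.aeval (n := 1) (fun i => ∑ j, C (rep p M g i j) * X j : Fin 3 → MvPolynomial (Fin 3) F)
    (fun i => IsHomogeneous.sum _ _ _ fun j _ => isHomogeneous_C_mul_X _ _)
  rwa [one_mul] at this

theorem act_homogeneousComponent (g : E p) (f : MvPolynomial (Fin 3) F) (n : ℕ) :
    act p M g (homogeneousComponent n f) = homogeneousComponent n (act p M g f) := by
  conv_rhs => rw [← sum_homogeneousComponent f]
  rw [map_sum, map_sum, Finset.sum_eq_single n]
  · exact (homogeneousComponent_eq_self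
      (act_isHomogeneous g (homogeneousComponent_isHomogeneous n f))).symm
  · intro k _ hk
    rw [homogeneousComponent_of_mem
      ((mem_homogeneousSubmodule _ _).mpr
        (act_isHomogeneous g (homogeneousComponent_isHomogeneous k f))), if_neg hk.symm]
  · intro hn
    rw [homogeneousComponent_eq_zero n f (by simpa using hn)]
    simp

theorem homogeneousComponent_mem_invariants {f : MvPolynomial (Fin 3) F}
    (hf : f ∈ invariants p M) (n : ℕ) : homogeneousComponent n f ∈ invariants p M := by
  intro g
  rw [act_homogeneousComponent, hf g]

theorem orbitNorm_X_isHomogeneous (i : Fin 3)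
    (hi : Function.Injective fun g : E p => act p M g (X i)) :
    (orbitNorm p M (X i)).IsHomogeneous (p ^ 4) := by
  rw [orbitNorm_eq_prod _ hi]
  have := IsHomogeneous.prod Finset.univ (fun g : E p => act p M g (X i)) (fun _ => 1)
    (fun g _ => act_isHomogeneous g (isHomogeneous_X F i))
  simpa [card_E] using this

theorem delta_isHomogeneous : (delta : MvPolynomial (Fin 3) F).IsHomogeneous 2 :=
  ((isHomogeneous_X F 1).pow 2).sub ((isHomogeneous_X F 2).mul (isHomogeneous_X F 0))

theorem fHat₁_isHomogeneous : (fHat₁ p M).IsHomogeneous (p ^ 2) := by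
  have hp : 2 ≤ p := (Fact.out : p.Prime).two_le
  have h4 : p * 2 ≤ p ^ 2 := by rw [sq]; exact Nat.mul_le_mul_left p hp
  refine ((IsHomogeneous.add ?_ ?_).add ?_).add ?_
  · exact isHomogeneous_X_pow 1 _
  · refine isHomogeneous_of_degree_eq ((isHomogeneous_C_mul_X_pow _ 1 p).mul (isHomogeneous_X_pow 2 (p ^ 2 - p))) ?_
    omega
  · refine isHomogeneous_of_degree_eq ((delta_isHomogeneous.C_mul _).mul (isHomogeneous_X_pow 2 (p ^ 2 - 2))) ?_
    omega
  · refine isHomogeneous_of_degree_eq ((isHomogeneous_C_mul_X _ 1).mul (isHomogeneous_X_pow 2 (p ^ 2 - 1))) ?_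
    omega

theorem hTilde₂_isHomogeneous (hp : 2 < p) (h1357 : gam p M 1 3 5 7 ≠ 0) :
    (hTilde₂ p M).IsHomogeneous (p ^ 4) := by
  obtain ⟨n, hn⟩ : ∃ n, p = n + 3 := ⟨p - 3, by omega⟩
  refine ((IsHomogeneous.sub ?_ ?_).add ?_).add ?_
  · exact orbitNorm_X_isHomogeneous 1 (act_X_one_injective h1357)
  · refine isHomogeneous_of_degree_eq (fHat₁_isHomogeneous.pow (p ^ 2)) ?_
    ring
  · refine isHomogeneous_of_degree_eq (((fHat₁_isHomogeneous.pow p).C_mul _).mul (isHomogeneous_X_pow 2 (p ^ 4 - p ^ 3))) ?_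
    have : p ^ 3 ≤ p ^ 4 := Nat.pow_le_pow_right (by omega) (by norm_num)
    rw [← pow_succ]
    exact Nat.add_sub_cancel' this
  · refine isHomogeneous_of_degree_eq (((fHat₁_isHomogeneous.pow 2).C_mul _).mul
      (isHomogeneous_X_pow 2 (p ^ 4 - 2 * p ^ 2))) ?_
    have : 2 * p ^ 2 ≤ p ^ 4 := by subst hn; ring_nf; omega
    omega

theorem h₂_mem_invariants (hp : 2 < p) (h1234 : gam p M 1 2 3 4 ≠ 0)
    (h1235 : gam p M 1 2 3 5 = 0)
    (h1357 : gam p M 1 3 5 7 ≠ 0) (h1245 : gam p M 1 2 4 5 ≠ 0) :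
    h₂ p M ∈ invariants p M ∧ (h₂ p M).IsHomogeneous (p ^ 2 + p) := by
  have h := (exists_h₂_eq hp h1234 h1235 h1357 h1245).2
  have hc : 2 * coeffL p M ^ p ^ 2 * coeffA p M ≠ 0 :=
    mul_ne_zero (mul_ne_zero (two_ne_zero_of_charP hp F)
      (pow_ne_zero _ (coeffL_ne_zero h1234 h1235 h1357))) (coeffA_ne_zero h1234 h1245)
  have hX : X 2 ∈ invariants p M := act_X_two
  have hC : ∀ c : F, C c ∈ invariants p M := fun c g => act_C g c
  have hf := fHat₁_mem_invariants h1234 h1235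
  constructor
  · refine mem_invariants_of_mul (mul_mem (hC _) (pow_mem hX (p ^ 4 - p ^ 2 - p)))
      (mul_ne_zero (C_ne_zero.mpr hc) (pow_ne_zero _ (X_ne_zero _))) ?_
    rw [← h]
    exact add_mem (add_mem (sub_mem (orbitNorm_mem_invariants _ (act_X_one_injective h1357))
      (pow_mem hf _)) (mul_mem (mul_mem (hC _) (pow_mem hf _)) (pow_mem hX _)))
      (mul_mem (mul_mem (hC _) (pow_mem hf _)) (pow_mem hX _))
  · refine isHomogeneous_of_C_mul_X_pow_mul (i := 2) (m := p ^ 4 - p ^ 2 - p) hc ?_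
    rw [← h]
    refine isHomogeneous_of_degree_eq (hTilde₂_isHomogeneous hp h1357) ?_
    obtain ⟨n, hn⟩ : ∃ n, p = n + 3 := ⟨p - 3, by omega⟩
    have : p ^ 2 + p ≤ p ^ 4 := by subst hn; ring_nf; omega
    omega

theorem hTilde₃_isHomogeneous (hp : 2 < p) (h1234 : gam p M 1 2 3 4 ≠ 0)
    (h1235 : gam p M 1 2 3 5 = 0)
    (h1357 : gam p M 1 3 5 7 ≠ 0) (h1245 : gam p M 1 2 4 5 ≠ 0) :
    (hTilde₃ p M).IsHomogeneous (p ^ 3 + p ^ 2) := by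
  have h2 := (h₂_mem_invariants hp h1234 h1235 h1357 h1245).2
  obtain ⟨n, hn⟩ : ∃ n, p = n + 3 := ⟨p - 3, by omega⟩
  refine (IsHomogeneous.sub ?_ ?_).add ?_
  · refine isHomogeneous_of_degree_eq (fHat₁_isHomogeneous.pow (p + 1)) ?_
    ring
  · refine isHomogeneous_of_degree_eq (h2.pow p) ?_
    ring
  · refine isHomogeneous_of_degree_eq ((((fHat₁_isHomogeneous.pow (p - 2)).C_mul _).mul (h2.pow 2)).mul
      (isHomogeneous_X_pow 2 (p ^ 2 - 2 * p))) ?_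
    have e1 : p ^ 2 - 2 * p = n ^ 2 + 4 * n + 3 := Nat.sub_eq_of_eq_add (by rw [hn]; ring)
    have e2 : p - 2 = n + 1 := by omega
    rw [e1, e2, hn]
    ring

theorem h₃_mem_invariants (hp : 2 < p) (h1234 : gam p M 1 2 3 4 ≠ 0)
    (h1235 : gam p M 1 2 3 5 = 0)
    (h1357 : gam p M 1 3 5 7 ≠ 0) (h1245 : gam p M 1 2 4 5 ≠ 0) :
    h₃ p M ∈ invariants p M ∧ (h₃ p M).IsHomogeneous (p ^ 3 + p + 2) := by
  have h := (exists_h₃_eq hp h1234 h1235 h1357 h1245).2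
  have hc : 2 * coeffMu p M ^ (p + 1) ≠ 0 :=
    mul_ne_zero (two_ne_zero_of_charP hp F) (pow_ne_zero _
      (div_ne_zero (coeffL_ne_zero h1234 h1235 h1357) (coeffA_ne_zero h1234 h1245)))
  have hX : X 2 ∈ invariants p M := act_X_two
  have hC : ∀ c : F, C c ∈ invariants p M := fun c g => act_C g c
  have hf := fHat₁_mem_invariants h1234 h1235
  have h2 := (h₂_mem_invariants hp h1234 h1235 h1357 h1245).1
  constructor
  · refine mem_invariants_of_mul (mul_mem (hC _) (pow_mem hX (p ^ 2 - p - 2)))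
      (mul_ne_zero (C_ne_zero.mpr hc) (pow_ne_zero _ (X_ne_zero _))) ?_
    rw [← h]
    exact add_mem (sub_mem (pow_mem hf _) (pow_mem h2 _))
      (mul_mem (mul_mem (mul_mem (hC _) (pow_mem hf _)) (pow_mem h2 _)) (pow_mem hX _))
  · refine isHomogeneous_of_C_mul_X_pow_mul (i := 2) (m := p ^ 2 - p - 2) hc ?_
    rw [← h]
    refine isHomogeneous_of_degree_eq (hTilde₃_isHomogeneous hp h1234 h1235 h1357 h1245) ?_
    obtain ⟨n, hn⟩ : ∃ n, p = n + 3 := ⟨p - 3, by omega⟩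
    have : p + 2 ≤ p ^ 2 := by subst hn; ring_nf; omega
    omega

/-! ### Lead monomials of the generators -/

variable (p M) in
/-- The standing assumptions on `p` and on the minors of `Γ(M)`. -/
structure Admissible : Prop where
  two_lt : 2 < p
  gam1234 : gam p M 1 2 3 4 ≠ 0
  gam1235 : gam p M 1 2 3 5 = 0
  gam1357 : gam p M 1 3 5 7 ≠ 0
  gam1245 : gam p M 1 2 4 5 ≠ 0

theorem degree_eq_of_support_le {f : MvPolynomial (Fin 3) F} {d : Fin 3 →₀ ℕ}
    (hd : coeff d f ≠ 0) (h : ∀ e ∈ f.support, grevlex.toSyn e ≤ grevlex.toSyn d) :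
    grevlex.degree f = d := by
  apply grevlex.toSyn.injective
  exact le_antisymm (grevlex.degree_le_iff.mpr h) (grevlex.le_degree (mem_support_iff.mpr hd))

theorem degree_fin_three (e : Fin 3 →₀ ℕ) : e.degree = e 0 + e 1 + e 2 := by
  rw [Finsupp.degree_eq_sum, Fin.sum_univ_three]

theorem degree_eq_of_mem_support {σ : Type*} {f : MvPolynomial σ F} {d : ℕ}
    (hf : f.IsHomogeneous d) {e : σ →₀ ℕ} (he : e ∈ f.support) : e.degree = d := by
  by_contra h
  exact (mem_support_iff.mp he) (hf.coeff_eq_zero h)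

/-- Within one degree, grevlex places every multiple of x below every monomial free of x, so the
lead term can be read off modulo x. -/
theorem degree_eq_single_one {f w : MvPolynomial (Fin 3) F} {d : ℕ} (hf : f.IsHomogeneous d)
    (hw : f = X 1 ^ d + X 2 * w) : grevlex.degree f = Finsupp.single 1 d ∧ f ≠ 0 := by
  have hc : coeff (Finsupp.single 1 d) f ≠ 0 := by
    rw [hw, coeff_add, coeff_X_mul', coeff_X_pow]
    simp
  refine ⟨degree_eq_of_support_le hc fun e he => ?_, fun h => hc (by rw [h, coeff_zero])⟩
  have hdeg := degree_eq_of_mem_support hf he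
  rw [degree_fin_three] at hdeg
  by_cases h2 : e 2 = 0
  · rw [mem_support_iff, hw, coeff_add, coeff_X_mul', if_neg (by simpa using h2), add_zero,
      coeff_X_pow] at he
    rw [← (ite_ne_right_iff.mp he).1]
  · refine ((grevlex_lt_iff _ _).mpr (Or.inr ⟨?_, Or.inl ?_⟩)).le
    · simpa using hdeg
    · simpa using Nat.pos_of_ne_zero h2

theorem degree_eq_single_zero {f : MvPolynomial (Fin 3) F} {d : ℕ} (hf : f.IsHomogeneous d)
    (hc : coeff (Finsupp.single 0 d) f ≠ 0) : grevlex.degree f = Finsupp.single 0 d := by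
  refine degree_eq_of_support_le hc fun e he => ?_
  have hdeg := degree_eq_of_mem_support hf he
  rw [degree_fin_three] at hdeg
  refine not_lt.mp fun hlt => ?_
  rw [grevlex_lt_iff] at hlt
  simp at hlt
  omega

namespace Admissible

variable (H : Admissible p M)
include H

theorem degree_orbitNorm_X_zero :
    grevlex.degree (orbitNorm p M (X 0)) = Finsupp.single 0 (p ^ 4) ∧
      orbitNorm p M (X 0) ≠ 0 := by
  rw [orbitNorm_eq_prod _ (act_X_zero_injective H.two_lt H.gam1357)]
  have hc : ∀ g : E p, coeff (Finsupp.single 0 1) (act p M g (X 0)) = 1 := by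
    intro g
    simp only [act_X_zero, coeff_add, coeff_C_mul, coeff_X]
    simp [Finsupp.single_left_inj]
  have h0 : ∀ g : E p, act p M g (X 0) ≠ 0 := fun g h => by
    have := hc g
    rw [h, coeff_zero] at this
    exact zero_ne_one this
  refine ⟨?_, Finset.prod_ne_zero_iff.mpr fun g _ => h0 g⟩
  rw [grevlex.degree_prod fun g _ => h0 g]
  rw [Finset.sum_congr rfl fun g _ => degree_eq_single_zero
    (act_isHomogeneous g (isHomogeneous_X F 0)) (by rw [hc g]; exact one_ne_zero)]
  simp

theorem gens_mem (i : Fin 5) : gens p M i ∈ invariants p M := by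
  obtain ⟨hp, h1, h2, h3, h4⟩ := H
  fin_cases i
  · exact act_X_two
  · exact fHat₁_mem_invariants h1 h2
  · exact (h₂_mem_invariants hp h1 h2 h3 h4).1
  · exact (h₃_mem_invariants hp h1 h2 h3 h4).1
  · exact orbitNorm_mem_invariants _ (act_X_zero_injective hp h3)

theorem gens_isHomogeneous (i : Fin 5) : (gens p M i).IsHomogeneous (genDegrees p i) := by
  obtain ⟨hp, h1, h2, h3, h4⟩ := H
  fin_cases i
  · exact isHomogeneous_X F 2
  · exact fHat₁_isHomogeneous
  · exact (h₂_mem_invariants hp h1 h2 h3 h4).2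
  · exact (h₃_mem_invariants hp h1 h2 h3 h4).2
  · exact orbitNorm_X_isHomogeneous _ (act_X_zero_injective hp h3)

end Admissible

variable (p) in
/-- The exponents of the lead monomials of the generators. -/
def genExp : Fin 5 → Fin 3 →₀ ℕ :=
  ![Finsupp.single 2 1, Finsupp.single 1 (p ^ 2), Finsupp.single 1 (p ^ 2 + p),
    Finsupp.single 1 (p ^ 3 + p + 2), Finsupp.single 0 (p ^ 4)]

theorem Admissible.degree_gens (H : Admissible p M) (i : Fin 5) :
    grevlex.degree (gens p M i) = genExp p i ∧ gens p M i ≠ 0 := by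
  have hhom := H.gens_isHomogeneous
  have hlast := H.degree_orbitNorm_X_zero
  obtain ⟨hp, h1, h2, h3, h4⟩ := H
  fin_cases i
  · exact ⟨grevlex.degree_X, X_ne_zero _⟩
  · have e : p ^ 2 - p = (p ^ 2 - p - 1) + 1 := by
      have : p < p ^ 2 := lt_self_pow₀ (by omega) (by norm_num)
      omega
    refine degree_eq_single_one (w := X 2 ^ (p ^ 2 - p - 1) * fTail p M) (hhom 1) ?_
    change fHat₁ p M = _
    rw [fHat₁_eq_add hp, e, pow_succ]
    simp only [Nat.add_sub_cancel]
    ring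
  · obtain ⟨w, hw⟩ := (exists_h₂_eq hp h1 h2 h3 h4).1
    refine degree_eq_single_one (w := C (coeffMu p M) * X 1 ^ p ^ 2 * delta * X 2 ^ (p - 3)
      + X 2 ^ (p - 2) * w) (hhom 2) ?_
    change h₂ p M = _
    have e4 : p - 2 = (p - 3) + 1 := by omega
    have e5 : p - 1 = (p - 2) + 1 := by omega
    rw [hw, e5, pow_succ, e4, pow_succ]
    ring
  · obtain ⟨w, hw⟩ := (exists_h₃_eq hp h1 h2 h3 h4).1
    refine degree_eq_single_one (w := w - X 1 ^ (p ^ 3 + p) * X 0) (hhom 3) ?_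
    change h₃ p M = _
    rw [hw, delta]
    ring
  · exact hlast

variable (p) in
/-- The exponent of the lead monomial of a power product of the generators. -/
def leadExp (I : Fin 5 →₀ ℕ) : Fin 3 →₀ ℕ :=
  Finsupp.single 0 (p ^ 4 * I 4)
    + Finsupp.single 1 (p ^ 2 * I 1 + (p ^ 2 + p) * I 2 + (p ^ 3 + p + 2) * I 3)
    + Finsupp.single 2 (I 0)

theorem leadExp_zero (I : Fin 5 →₀ ℕ) : leadExp p I 0 = p ^ 4 * I 4 := by simp [leadExp]

theorem leadExp_one (I : Fin 5 →₀ ℕ) :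
    leadExp p I 1 = p ^ 2 * I 1 + (p ^ 2 + p) * I 2 + (p ^ 3 + p + 2) * I 3 := by simp [leadExp]

theorem leadExp_two (I : Fin 5 →₀ ℕ) : leadExp p I 2 = I 0 := by simp [leadExp]

theorem weight_genDegrees (I : Fin 5 →₀ ℕ) : Finsupp.weight (genDegrees p) I
    = I 0 + p ^ 2 * I 1 + (p ^ 2 + p) * I 2 + (p ^ 3 + p + 2) * I 3 + p ^ 4 * I 4 := by
  rw [Finsupp.weight_apply, Finsupp.sum_fintype _ _ (by simp), Fin.sum_univ_five]
  simp [genDegrees, mul_comm]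

theorem degree_leadExp (I : Fin 5 →₀ ℕ) :
    (leadExp p I).degree = Finsupp.weight (genDegrees p) I := by
  rw [degree_fin_three, leadExp_zero, leadExp_one, leadExp_two, weight_genDegrees]
  ring

theorem aeval_monomial_eq {n : ℕ} (h : Fin n → MvPolynomial (Fin 3) F) (I : Fin n →₀ ℕ) (c : F) :
    aeval h (monomial I c) = C c * powerProduct h I := by
  rw [aeval_monomial, Finsupp.prod_fintype _ _ (by simp), powerProduct, algebraMap_eq]

namespace Admissible

variable (H : Admissible p M)
include H

theorem powerProduct_ne_zero (I : Fin 5 →₀ ℕ) : powerProduct (gens p M) I ≠ 0 :=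
  Finset.prod_ne_zero_iff.mpr fun i _ => pow_ne_zero _ (H.degree_gens i).2

theorem degree_powerProduct (I : Fin 5 →₀ ℕ) :
    grevlex.degree (powerProduct (gens p M) I) = leadExp p I := by
  rw [powerProduct, grevlex.degree_prod fun i _ => pow_ne_zero _ (H.degree_gens i).2]
  simp only [grevlex.degree_pow, (H.degree_gens _).1, Fin.sum_univ_five, leadExp, genExp]
  ext i
  fin_cases i <;> simp <;> ring

theorem powerProduct_isHomogeneous (I : Fin 5 →₀ ℕ) :
    (powerProduct (gens p M) I).IsHomogeneous (Finsupp.weight (genDegrees p) I) := by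
  have := IsHomogeneous.prod Finset.univ (fun i => gens p M i ^ I i) (fun i => genDegrees p i * I i)
    (fun i _ => (H.gens_isHomogeneous i).pow _)
  rw [Finsupp.weight_apply, Finsupp.sum_fintype _ _ (by simp)]
  simpa [mul_comm, powerProduct] using this

theorem powerProduct_mem (I : Fin 5 →₀ ℕ) : powerProduct (gens p M) I ∈ invariants p M :=
  prod_mem fun i _ => pow_mem (H.gens_mem i) _

end Admissible

/-! ### Standard exponents -/

variable (p) in
/-- The exponents of the power products that are not divisible by `h₂^p` or `h₃^p`. -/
def IsStandard (I : Fin 5 →₀ ℕ) : Prop := I 2 < p ∧ I 3 < p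

/-- The y-exponent is 2I₃ modulo p, and p is odd, so I₃ < p is determined. After removing its
contribution and dividing by p, the residue modulo p is I₂, and then I₁ follows. -/
theorem leadExp_injOn (hp : 2 < p) {I J : Fin 5 →₀ ℕ} (hI : IsStandard p I)
    (hJ : IsStandard p J) (h : leadExp p I = leadExp p J) : I = J := by
  have h0 := DFunLike.congr_fun h 0
  have h1 := DFunLike.congr_fun h 1
  have h2 := DFunLike.congr_fun h 2
  rw [leadExp_zero, leadExp_zero] at h0
  rw [leadExp_one, leadExp_one] at h1
  rw [leadExp_two, leadExp_two] at h2
  have hp0 : 0 < p := by omega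
  have h4 : I 4 = J 4 := Nat.eq_of_mul_eq_mul_left (pow_pos hp0 4) h0
  have hcop : Nat.Coprime p 2 := by
    rw [Nat.coprime_comm]
    exact ((Nat.coprime_primes Nat.prime_two Fact.out).mpr (by omega))
  have h3 : I 3 = J 3 := by
    have hmod : 2 * I 3 ≡ 2 * J 3 [MOD p] := by
      have := congrArg (· % p) h1
      have e : ∀ K : Fin 5 →₀ ℕ, p ^ 2 * K 1 + (p ^ 2 + p) * K 2 + (p ^ 3 + p + 2) * K 3
          = 2 * K 3 + p * (p * K 1 + (p + 1) * K 2 + (p ^ 2 + 1) * K 3) := fun K => by ring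
      simp only [e, Nat.add_mul_mod_self_left] at this
      exact this
    exact Nat.ModEq.eq_of_lt_of_lt (Nat.ModEq.cancel_left_of_coprime hcop hmod) hI.2 hJ.2
  rw [h3] at h1
  have h1' : p * I 1 + (p + 1) * I 2 = p * J 1 + (p + 1) * J 2 := by
    apply Nat.eq_of_mul_eq_mul_left hp0
    linarith
  have h2' : I 2 = J 2 := by
    have hmod : I 2 ≡ J 2 [MOD p] := by
      have := congrArg (· % p) h1'
      have e : ∀ K : Fin 5 →₀ ℕ, p * K 1 + (p + 1) * K 2
          = K 2 + p * (K 1 + K 2) := fun K => by ring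
      simp only [e, Nat.add_mul_mod_self_left] at this
      exact this
    exact Nat.ModEq.eq_of_lt_of_lt hmod hI.1 hJ.1
  rw [h2'] at h1'
  have h1'' : I 1 = J 1 := Nat.eq_of_mul_eq_mul_left hp0 (by omega)
  ext i
  fin_cases i <;> assumption

/-! ### Polynomials whose leading coefficient is a unit -/

/-- `G` has degree `n` and its leading coefficient is a unit. -/
def IsUnitLead {R : Type*} [CommRing R] (G : Polynomial R) (n : ℕ) : Prop :=
  G.natDegree = n ∧ IsUnit G.leadingCoeff

namespace IsUnitLead

variable {R : Type*} [CommRing R] [IsDomain R]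

theorem ne_zero {G : Polynomial R} {n : ℕ} (h : IsUnitLead G n) : G ≠ 0 :=
  Polynomial.leadingCoeff_ne_zero.mp h.2.ne_zero

theorem mul {G G' : Polynomial R} {n n' : ℕ} (h : IsUnitLead G n) (h' : IsUnitLead G' n') :
    IsUnitLead (G * G') (n + n') :=
  ⟨by rw [Polynomial.natDegree_mul h.ne_zero h'.ne_zero, h.1, h'.1],
    by rw [Polynomial.leadingCoeff_mul]; exact h.2.mul h'.2⟩

theorem pow {G : Polynomial R} {n : ℕ} (h : IsUnitLead G n) (k : ℕ) :
    IsUnitLead (G ^ k) (k * n) :=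
  ⟨by rw [Polynomial.natDegree_pow, h.1], by rw [Polynomial.leadingCoeff_pow]; exact h.2.pow k⟩

theorem prod {ι : Type*} {s : Finset ι} {G : ι → Polynomial R} {n : ℕ}
    (h : ∀ i ∈ s, IsUnitLead (G i) n) : IsUnitLead (∏ i ∈ s, G i) (s.card * n) := by
  refine ⟨?_, ?_⟩
  · rw [Polynomial.natDegree_prod _ _ fun i hi => (h i hi).ne_zero,
      Finset.sum_congr rfl fun i hi => (h i hi).1, Finset.sum_const, smul_eq_mul]
  · rw [Polynomial.leadingCoeff_prod]
    exact IsUnit.prod_iff.mpr fun i hi => (h i hi).2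

theorem add {G L : Polynomial R} {n : ℕ} (h : IsUnitLead G n) (hL : L.natDegree < n) :
    IsUnitLead (G + L) n := by
  rw [← h.1] at hL
  exact ⟨by rw [Polynomial.natDegree_add_eq_left_of_natDegree_lt hL, h.1],
    by rw [Polynomial.leadingCoeff_add_of_degree_lt' (Polynomial.degree_lt_degree hL)]; exact h.2⟩

theorem neg {G : Polynomial R} {n : ℕ} (h : IsUnitLead G n) : IsUnitLead (-G) n :=
  ⟨by rw [Polynomial.natDegree_neg, h.1], by rw [Polynomial.leadingCoeff_neg]; exact h.2.neg⟩

theorem C_mul_iff {G : Polynomial R} {n : ℕ} {c : R} (hc : IsUnit c) :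
    IsUnitLead (Polynomial.C c * G) n ↔ IsUnitLead G n := by
  rw [IsUnitLead, IsUnitLead, Polynomial.natDegree_C_mul hc.ne_zero, Polynomial.leadingCoeff_mul,
    Polynomial.leadingCoeff_C, IsUnit.mul_iff, and_iff_right hc]

theorem comp {G L : Polynomial R} {n : ℕ} (h : IsUnitLead G n) (hL : IsUnitLead L 1) :
    IsUnitLead (G.comp L) n :=
  ⟨by rw [Polynomial.natDegree_comp, h.1, hL.1, mul_one], by
    rw [Polynomial.leadingCoeff_comp (by rw [hL.1]; exact one_ne_zero)]
    exact h.2.mul (hL.2.pow _)⟩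

theorem of_monic {G : Polynomial R} (h : G.Monic) : IsUnitLead G G.natDegree :=
  ⟨rfl, by rw [h.leadingCoeff]; exact isUnit_one⟩

end IsUnitLead

/-! ### Dehomogenization -/

variable (p M) in
/-- The image of `z` under dehomogenization, as a polynomial in `y` over `F[f̂₁]`. -/
def dehomZ : Polynomial (Polynomial F) :=
  Polynomial.C (Polynomial.C (coeffL p M)⁻¹) * (Polynomial.X ^ p ^ 2
    + (Polynomial.C (Polynomial.C (coeffA p M)) * Polynomial.X ^ p
    + Polynomial.C (Polynomial.C (coeffL p M)) * Polynomial.X ^ 2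
    + Polynomial.C (Polynomial.C (coeffB p M)) * Polynomial.X - Polynomial.C Polynomial.X))

variable (p M) in
/-- The substitution `x = 1`, with the result written as a polynomial in `y` over `F[f̂₁]`. -/
def dehom : MvPolynomial (Fin 3) F →ₐ[F] Polynomial (Polynomial F) :=
  aeval ![dehomZ p M, Polynomial.X, 1]

theorem dehom_X_zero : dehom p M (X 0) = dehomZ p M := by simp [dehom]
theorem dehom_X_one : dehom p M (X 1) = Polynomial.X := by simp [dehom]
theorem dehom_X_two : dehom p M (X 2) = 1 := by simp [dehom]
theorem dehom_C (c : F) : dehom p M (C c) = Polynomial.C (Polynomial.C c) :=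
  (dehom p M).commutes c

theorem C_C_inv_mul {c : F} (hc : c ≠ 0) :
    (Polynomial.C (Polynomial.C c⁻¹) : Polynomial (Polynomial F)) * Polynomial.C (Polynomial.C c)
      = 1 := by
  rw [← map_mul, ← map_mul, inv_mul_cancel₀ hc, map_one, map_one]

theorem C_mul_dehomZ (hL : coeffL p M ≠ 0) :
    Polynomial.C (Polynomial.C (coeffL p M)) * dehomZ p M = Polynomial.X ^ p ^ 2
    + (Polynomial.C (Polynomial.C (coeffA p M)) * Polynomial.X ^ p
    + Polynomial.C (Polynomial.C (coeffL p M)) * Polynomial.X ^ 2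
    + Polynomial.C (Polynomial.C (coeffB p M)) * Polynomial.X - Polynomial.C Polynomial.X) := by
  rw [dehomZ, ← mul_assoc, mul_comm (Polynomial.C (Polynomial.C (coeffL p M))), C_C_inv_mul hL,
    one_mul]

/-- `dehomZ` is the solution for z of f̂₁ = t at x = 1, which exists because z occurs there linearly
with nonzero coefficient. -/
theorem dehom_fHat₁ (hL : coeffL p M ≠ 0) : dehom p M (fHat₁ p M) = Polynomial.C Polynomial.X := by
  have h := C_mul_dehomZ hL
  simp only [fHat₁_eq, delta, map_add, map_sub, map_mul, map_pow, dehom_C, dehom_X_zero,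
    dehom_X_one, dehom_X_two, one_pow, mul_one, one_mul]
  linear_combination -h

variable (p M) in
/-- The translation `y ↦ y + c₁(g) x` in dehomogenized form. -/
def shift (g : Fin 4 → ZMod p) : Polynomial (Polynomial F) :=
  Polynomial.X + Polynomial.C (Polynomial.C (rowComb p M 0 g))

theorem shift_isUnitLead (g : Fin 4 → ZMod p) : IsUnitLead (shift p M g) 1 := by
  have := IsUnitLead.of_monic (Polynomial.monic_X_add_C (Polynomial.C (rowComb p M 0 g)))
  rwa [Polynomial.natDegree_X_add_C] at this

/-- In the coordinates t and y the group moves only y. On the variable z this amounts to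
`rowComb_relation`, after multiplying by the coefficient of δ in f̂₁. -/
theorem dehom_act (H : Admissible p M) (g : E p) (f : MvPolynomial (Fin 3) F) :
    dehom p M (act p M g f) = (dehom p M f).comp (shift p M g.toAdd) := by
  have hL := coeffL_ne_zero H.gam1234 H.gam1235 H.gam1357
  have h : (dehom p M).toRingHom.comp (act p M g).toRingHom
      = (Polynomial.compRingHom (shift p M g.toAdd)).comp (dehom p M).toRingHom := by
    apply MvPolynomial.ringHom_ext
    · intro c
      simp
    · intro i
      fin_cases i
      · have hC0 : (Polynomial.C (Polynomial.C (coeffL p M)) : Polynomial (Polynomial F)) ≠ 0 := by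
          simpa using hL
        apply mul_left_cancel₀ hC0
        have hz := C_mul_dehomZ hL
        have hz' := congrArg (fun G => G.comp (shift p M g.toAdd)) hz
        have hrel := congrArg (fun c => Polynomial.C (Polynomial.C c))
          (rowComb_relation H.gam1234 H.gam1235 g.toAdd)
        simp only [map_add, map_sub, map_mul, map_pow, map_zero] at hrel
        simp only [Polynomial.mul_comp, Polynomial.add_comp, Polynomial.sub_comp,
          Polynomial.pow_comp, Polynomial.C_comp, Polynomial.X_comp, shift, add_pow_char_pow,
          add_pow_char] at hz'
        simp only [Fin.zero_eta, AlgHom.toRingHom_eq_coe, RingHom.coe_comp, RingHom.coe_coe,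
          Function.comp_apply, Polynomial.coe_compRingHom, act_X_zero, map_add, map_mul, dehom_C,
          dehom_X_zero, dehom_X_one, dehom_X_two, map_pow, map_ofNat, shift]
        linear_combination hz - hz' - hrel
      · simp [act_X_one, dehom_X_one, dehom_X_two, shift]
      · simp [act_X_two, dehom_X_two]
  exact RingHom.congr_fun h f

/-- In a fixed degree the exponent of x is determined by those of y and z, so setting x = 1 merges
no monomials. -/
theorem eq_zero_of_specialize {f : MvPolynomial (Fin 3) F} {d : ℕ} (hf : f.IsHomogeneous d)
    (h : aeval ![X 0, X 1, (1 : MvPolynomial (Fin 3) F)] f = 0) : f = 0 := by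
  by_contra hne
  obtain ⟨e, he⟩ := ne_zero_iff.mp hne
  have hdeg := degree_eq_of_mem_support hf (mem_support_iff.mpr he)
  rw [degree_fin_three] at hdeg
  rw [aeval_def, eval₂_eq'] at h
  have hmon : ∀ k ∈ f.support, (algebraMap F (MvPolynomial (Fin 3) F)) (coeff k f) *
      ∏ i, (![X 0, X 1, (1 : MvPolynomial (Fin 3) F)]) i ^ k i
      = monomial (Finsupp.single 0 (k 0) + Finsupp.single 1 (k 1)) (coeff k f) := by
    intro k _
    rw [Fin.prod_univ_three]
    simp [X_pow_eq_monomial, algebraMap_eq, C_mul_monomial, monomial_mul]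
  rw [Finset.sum_congr rfl hmon] at h
  have hc := congrArg (coeff (Finsupp.single 0 (e 0) + Finsupp.single 1 (e 1))) h
  rw [coeff_sum, Finset.sum_eq_single e, coeff_monomial, if_pos rfl, coeff_zero] at hc
  · exact he hc
  · intro k hk hke
    rw [coeff_monomial, if_neg]
    intro hek
    have h0 := DFunLike.congr_fun hek 0
    have h1 := DFunLike.congr_fun hek 1
    simp at h0 h1
    have hdk := degree_eq_of_mem_support hf hk
    rw [degree_fin_three] at hdk
    apply hke
    ext i
    fin_cases i
    · exact h0
    · exact h1
    · simp; omega
  · intro hn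
    exact absurd (mem_support_iff.mpr he) hn

theorem eq_zero_of_dehom_eq_zero (hL : coeffL p M ≠ 0) {f : MvPolynomial (Fin 3) F} {d : ℕ}
    (hf : f.IsHomogeneous d) (h : dehom p M f = 0) : f = 0 := by
  apply eq_zero_of_specialize hf
  let t : MvPolynomial (Fin 3) F := X 1 ^ p ^ 2 + C (coeffA p M) * X 1 ^ p
    + C (coeffL p M) * (X 1 ^ 2 - X 0) + C (coeffB p M) * X 1
  -- Substituting f̂₁ at x = 1 back for t undoes the change of coordinates, leaving the plain
  -- specialization x = 1.
  let s : Polynomial (Polynomial F) →+* MvPolynomial (Fin 3) F :=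
    Polynomial.eval₂RingHom (Polynomial.aeval t).toRingHom (X 1)
  have hsC : ∀ c : F, s (Polynomial.C (Polynomial.C c)) = C c := fun c => by
    simp [s, algebraMap_eq]
  have hsX : s Polynomial.X = X 1 := by simp [s]
  have hst : s (Polynomial.C Polynomial.X) = t := by simp [s]
  have key : s.comp (dehom p M).toRingHom
      = (aeval ![X 0, X 1, (1 : MvPolynomial (Fin 3) F)]).toRingHom := by
    apply MvPolynomial.ringHom_ext
    · intro c
      simp [hsC, algebraMap_eq]
    · intro i
      fin_cases i
      · have hC0 : (C (coeffL p M) : MvPolynomial (Fin 3) F) ≠ 0 := C_ne_zero.mpr hL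
        apply mul_left_cancel₀ hC0
        have hz := congrArg s (C_mul_dehomZ hL)
        simp only [map_add, map_sub, map_mul, map_pow, hsC, hsX, hst] at hz
        simp only [Fin.zero_eta, AlgHom.toRingHom_eq_coe, RingHom.coe_comp, RingHom.coe_coe,
          Function.comp_apply, dehom_X_zero, aeval_X, Matrix.cons_val_zero]
        rw [hz]
        simp only [t]
        ring
      · simp [dehom_X_one, hsX]
      · simp [dehom_X_two]
  have := RingHom.congr_fun key f
  simp only [AlgHom.toRingHom_eq_coe, RingHom.coe_comp, RingHom.coe_coe, Function.comp_apply, h,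
    map_zero] at this
  exact this.symm

/-! ### Translation-invariant polynomials -/

variable (p M) in
/-- Invariance under the translations `y ↦ y + c₁(g)`. -/
def IsShiftInvariant (G : Polynomial (Polynomial F)) : Prop :=
  ∀ g : Fin 4 → ZMod p, G.comp (shift p M g) = G

variable (p M) in
/-- The product of the translates of `y`. -/
def shiftNorm : Polynomial (Polynomial F) :=
  ∏ g : Fin 4 → ZMod p, (Polynomial.X - Polynomial.C (Polynomial.C (rowComb p M 0 g)))

theorem shiftNorm_monic : (shiftNorm p M).Monic := Polynomial.monic_prod_X_sub_C _ _

theorem shiftNorm_natDegree : (shiftNorm p M).natDegree = p ^ 4 := by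
  rw [shiftNorm, Polynomial.natDegree_prod_of_monic _ _ fun g _ => Polynomial.monic_X_sub_C _]
  simp [ZMod.card]

theorem shiftNorm_isShiftInvariant : IsShiftInvariant p M (shiftNorm p M) := by
  intro g
  rw [shiftNorm, Polynomial.prod_comp]
  refine Fintype.prod_equiv (Equiv.subRight g) _ _ fun h => ?_
  simp only [Polynomial.sub_comp, Polynomial.X_comp, Polynomial.C_comp, shift,
    Equiv.subRight_apply, rowComb_sub, map_sub]
  ring

/-- Evaluating invariance at y = 0 shows that G − G(0) vanishes at all the distinct c₁(g), so the
norm divides it. The quotient is again invariant and has smaller degree. -/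
theorem IsShiftInvariant.exists_comp (h1357 : gam p M 1 3 5 7 ≠ 0) :
    ∀ (n : ℕ) (G : Polynomial (Polynomial F)), G.natDegree ≤ n → IsShiftInvariant p M G →
      ∃ K : Polynomial (Polynomial F), G = K.comp (shiftNorm p M) := by
  intro n
  induction n using Nat.strong_induction_on with
  | _ n ih =>
  intro G hGn hG
  by_cases hz : G - Polynomial.C (G.eval 0) = 0
  · refine ⟨Polynomial.C (G.eval 0), ?_⟩
    rw [Polynomial.C_comp]
    exact sub_eq_zero.mp hz
  have hdvd : shiftNorm p M ∣ G - Polynomial.C (G.eval 0) := by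
    let s : Multiset (Polynomial F) :=
      (Finset.univ : Finset (Fin 4 → ZMod p)).val.map fun g => Polynomial.C (rowComb p M 0 g)
    have hs : s.Nodup := Finset.univ.nodup.map fun g h hgh =>
      rowComb_zero_injective h1357 (Polynomial.C_injective hgh)
    have h := (Multiset.prod_X_sub_C_dvd_iff_le_roots hz s).mpr
      ((Multiset.le_iff_subset hs).mpr fun a ha => by
        obtain ⟨g, -, rfl⟩ := Multiset.mem_map.mp ha
        rw [Polynomial.mem_roots hz]
        have := congrArg (Polynomial.eval 0) (hG g)
        simp only [Polynomial.eval_comp, shift, Polynomial.eval_add, Polynomial.eval_X,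
          Polynomial.eval_C, zero_add] at this
        simp [this])
    rw [Multiset.map_map] at h
    exact h
  obtain ⟨Q, hQ⟩ := hdvd
  have hQ0 : Q ≠ 0 := by
    rintro rfl
    exact hz (by rw [hQ, mul_zero])
  have hdeg : G.natDegree = p ^ 4 + Q.natDegree := by
    rw [← Polynomial.natDegree_sub_C (a := G.eval 0), hQ,
      Polynomial.natDegree_mul shiftNorm_monic.ne_zero hQ0, shiftNorm_natDegree]
  have hQinv : IsShiftInvariant p M Q := by
    intro g
    have := congrArg (fun K => K.comp (shift p M g)) hQ
    simp only [Polynomial.sub_comp, Polynomial.mul_comp, Polynomial.C_comp, hG g,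
      shiftNorm_isShiftInvariant g] at this
    exact mul_left_cancel₀ shiftNorm_monic.ne_zero (this.symm.trans hQ)
  have hp4 : 0 < p ^ 4 := pow_pos (Fact.out : p.Prime).pos 4
  obtain ⟨K, hK⟩ := ih Q.natDegree (by omega) Q le_rfl hQinv
  refine ⟨Polynomial.C (G.eval 0) + Polynomial.X * K, ?_⟩
  rw [Polynomial.add_comp, Polynomial.C_comp, Polynomial.mul_comp, Polynomial.X_comp, ← hK, ← hQ]
  ring

theorem IsShiftInvariant.natDegree_eq (h1357 : gam p M 1 3 5 7 ≠ 0)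
    {G : Polynomial (Polynomial F)} (hG : IsShiftInvariant p M G) :
    ∃ n, G.natDegree = n * p ^ 4 := by
  obtain ⟨K, rfl⟩ := hG.exists_comp h1357 _ G le_rfl
  exact ⟨K.natDegree, by rw [Polynomial.natDegree_comp, shiftNorm_natDegree]⟩

theorem isShiftInvariant_dehom (H : Admissible p M) {f : MvPolynomial (Fin 3) F}
    (hf : f ∈ invariants p M) : IsShiftInvariant p M (dehom p M f) := by
  intro g
  have := dehom_act H (Multiplicative.ofAdd g) f
  rw [hf, toAdd_ofAdd] at this
  exact this.symm

/-! ### Degrees of the dehomogenized generators -/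

theorem isUnit_C_of_ne_zero {c : F} (hc : c ≠ 0) : IsUnit (Polynomial.C c) :=
  Polynomial.isUnit_C.mpr (isUnit_iff_ne_zero.mpr hc)

namespace Admissible

variable (H : Admissible p M)
include H

theorem coeffL_ne_zero : coeffL p M ≠ 0 :=
  RankFourInvariants.coeffL_ne_zero H.gam1234 H.gam1235 H.gam1357

theorem coeffA_ne_zero : coeffA p M ≠ 0 :=
  RankFourInvariants.coeffA_ne_zero H.gam1234 H.gam1245

theorem dehomZ_isUnitLead : IsUnitLead (dehomZ p M) (p ^ 2) := by
  have hp := H.two_lt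
  rw [dehomZ, IsUnitLead.C_mul_iff (isUnit_C_of_ne_zero (inv_ne_zero H.coeffL_ne_zero))]
  refine IsUnitLead.add ?_ ?_
  · have := IsUnitLead.of_monic (Polynomial.monic_X_pow (R := Polynomial F) (p ^ 2))
    rwa [Polynomial.natDegree_X_pow] at this
  · have h1 : p < p ^ 2 := lt_self_pow₀ (by omega) (by norm_num)
    refine lt_of_le_of_lt ?_ h1
    compute_degree
    omega

/-- A product of p⁴ translates of `dehomZ`, each of degree p² in y. -/
theorem dehom_orbitNorm_X_zero : IsUnitLead (dehom p M (orbitNorm p M (X 0))) (p ^ 4 * p ^ 2) := by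
  rw [orbitNorm_eq_prod _ (act_X_zero_injective H.two_lt H.gam1357), map_prod]
  have := IsUnitLead.prod (s := Finset.univ) (G := fun g : E p => dehom p M (act p M g (X 0)))
    (n := p ^ 2) fun g _ => by
      rw [dehom_act H, dehom_X_zero]
      exact H.dehomZ_isUnitLead.comp (shift_isUnitLead _)
  rwa [Finset.card_univ, card_E] at this

theorem dehom_h₂ : IsUnitLead (dehom p M (h₂ p M)) (p ^ 4) := by
  have h := congrArg (dehom p M)
    (exists_h₂_eq H.two_lt H.gam1234 H.gam1235 H.gam1357 H.gam1245).2
  have hc : 2 * coeffL p M ^ p ^ 2 * coeffA p M ≠ 0 :=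
    mul_ne_zero (mul_ne_zero (two_ne_zero_of_charP H.two_lt F)
      (pow_ne_zero _ H.coeffL_ne_zero)) H.coeffA_ne_zero
  rw [map_mul, map_mul, map_pow, dehom_X_two, one_pow, mul_one, dehom_C] at h
  have hp4 : 0 < p ^ 4 := pow_pos (by have := H.two_lt; omega) 4
  have hN : IsUnitLead (dehom p M (orbitNorm p M (X 1))) (p ^ 4) := by
    rw [orbitNorm_eq_prod _ (act_X_one_injective H.gam1357), map_prod]
    have := IsUnitLead.prod (s := Finset.univ) (G := fun g : E p => dehom p M (act p M g (X 1)))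
      (n := 1) fun g _ => by
        rw [dehom_act H, dehom_X_one, Polynomial.X_comp]
        exact shift_isUnitLead _
    rwa [Finset.card_univ, card_E, mul_one] at this
  have hsmall : ∀ c : Polynomial F, (Polynomial.C c).natDegree < p ^ 4 := fun c => by
    rwa [Polynomial.natDegree_C]
  -- Both x and f̂₁ become constants in y, so only N_M(y) contributes to the degree.
  have e : ∃ c, dehom p M (hTilde₂ p M) = dehom p M (orbitNorm p M (X 1)) + Polynomial.C c := by
    rw [hTilde₂]
    generalize gam p M 1 3 5 9 / gam p M 1 3 5 7
          + gam p M 1 2 4 5 ^ p ^ 2 / gam p M 1 2 3 4 ^ p ^ 2 = a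
    generalize gam p M 1 3 4 5 ^ p ^ 2 / gam p M 1 2 3 4 ^ p ^ 2 = b
    refine ⟨-Polynomial.X ^ p ^ 2 + Polynomial.C a * Polynomial.X ^ p
      + Polynomial.C b * Polynomial.X ^ 2, ?_⟩
    simp only [map_add, map_sub, map_neg, map_mul, map_pow, dehom_fHat₁ H.coeffL_ne_zero,
      dehom_X_two, dehom_C, one_pow, mul_one]
    ring
  obtain ⟨c, e⟩ := e
  rw [← IsUnitLead.C_mul_iff (isUnit_C_of_ne_zero hc), ← h, e]
  exact hN.add (hsmall c)

theorem dehom_h₃ : IsUnitLead (dehom p M (h₃ p M)) (p * p ^ 4) := by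
  have hp := H.two_lt
  have h := congrArg (dehom p M)
    (exists_h₃_eq H.two_lt H.gam1234 H.gam1235 H.gam1357 H.gam1245).2
  have hc : 2 * coeffMu p M ^ (p + 1) ≠ 0 :=
    mul_ne_zero (two_ne_zero_of_charP H.two_lt F) (pow_ne_zero _
      (div_ne_zero H.coeffL_ne_zero H.coeffA_ne_zero))
  rw [map_mul, map_mul, map_pow, dehom_X_two, one_pow, mul_one, dehom_C] at h
  have h2 := H.dehom_h₂
  have hp4 : 0 < p ^ 4 := pow_pos (by omega) 4
  -- Over the constants F[t] the term h₂^p dominates the h₂² term because 2 < p.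
  have e : ∃ c d, dehom p M (hTilde₃ p M) = -dehom p M (h₂ p M) ^ p + Polynomial.C c
      + Polynomial.C d * dehom p M (h₂ p M) ^ 2 := by
    rw [hTilde₃]
    generalize (gam p M 1 3 4 5 / gam p M 1 2 4 5) ^ p = a
    refine ⟨Polynomial.X ^ (p + 1), Polynomial.C a * Polynomial.X ^ (p - 2), ?_⟩
    simp only [map_add, map_sub, map_mul, map_pow, dehom_fHat₁ H.coeffL_ne_zero,
      dehom_X_two, dehom_C, one_pow, mul_one]
    ring
  obtain ⟨c, d, e⟩ := e
  rw [← IsUnitLead.C_mul_iff (isUnit_C_of_ne_zero hc), ← h, e]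
  refine IsUnitLead.add ((h2.pow p).neg.add ?_) ?_
  · rw [Polynomial.natDegree_C]
    exact Nat.mul_pos (by omega) hp4
  · refine (Polynomial.natDegree_C_mul_le _ _).trans_lt ?_
    rw [Polynomial.natDegree_pow, h2.1]
    exact Nat.mul_lt_mul_of_pos_right hp hp4

end Admissible

/-! ### Standard power products span the invariants -/

variable (F p) in
/-- The polynomials in the generators all of whose exponents are standard. -/
def standardPolys : Submodule F (MvPolynomial (Fin 5) F) :=
  restrictSupport F {I | IsStandard p I}

theorem mem_standardPolys {P : MvPolynomial (Fin 5) F} :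
    P ∈ standardPolys F p ↔ ∀ I ∈ P.support, IsStandard p I := by
  rw [standardPolys, mem_restrictSupport_iff]
  rfl

theorem monomial_mem_standardPolys {I : Fin 5 →₀ ℕ} (hI : IsStandard p I) (c : F) :
    monomial I c ∈ standardPolys F p := by
  rw [mem_standardPolys]
  intro J hJ
  rw [Finset.mem_singleton.mp (support_monomial_subset hJ)]
  exact hI

theorem powerProduct_add {n : ℕ} (h : Fin n → MvPolynomial (Fin 3) F) (I J : Fin n →₀ ℕ) :
    powerProduct h (I + J) = powerProduct h I * powerProduct h J := by
  simp [powerProduct, pow_add, Finset.prod_mul_distrib]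

theorem powerProduct_single {n : ℕ} (h : Fin n → MvPolynomial (Fin 3) F) (i : Fin n) (k : ℕ) :
    powerProduct h (Finsupp.single i k) = h i ^ k := by
  rw [powerProduct, Finset.prod_eq_single i]
  · simp
  · intro j _ hj
    rw [Finsupp.single_eq_of_ne hj, pow_zero]
  · simp

namespace Admissible

variable (H : Admissible p M)
include H

/-- The standard power products of degree `n p⁴` in `y`, with coefficients in `F[f̂₁]`. -/
theorem exists_isUnitLead_standard (n : ℕ) : ∃ π : Polynomial (Polynomial F),
    IsUnitLead π (n * p ^ 4) ∧ IsShiftInvariant p M π ∧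
      ∀ c : Polynomial F, ∃ P ∈ standardPolys F p,
        dehom p M (aeval (gens p M) P) = Polynomial.C c * π := by
  have hp0 : 0 < p := by have := H.two_lt; omega
  -- The two lowest base-p digits of n are the exponents of h₂ and h₃, and the rest goes to N_M(z),
  -- matching the degrees p⁴, p⁵, p⁶.
  let J : Fin 5 →₀ ℕ := Finsupp.single 2 (n % p) + Finsupp.single 3 (n / p % p)
    + Finsupp.single 4 (n / p / p)
  refine ⟨dehom p M (powerProduct (gens p M) J), ?_,
    isShiftInvariant_dehom H (H.powerProduct_mem J), ?_⟩
  · have h := ((H.dehom_h₂.pow (n % p)).mul (H.dehom_h₃.pow (n / p % p))).mul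
      (H.dehom_orbitNorm_X_zero.pow (n / p / p))
    have e : n % p * p ^ 4 + n / p % p * (p * p ^ 4) + n / p / p * (p ^ 4 * p ^ 2)
        = n * p ^ 4 := by
      have e1 := Nat.div_add_mod n p
      have e2 := Nat.div_add_mod (n / p) p
      calc _ = (p * (p * (n / p / p) + n / p % p) + n % p) * p ^ 4 := by ring
        _ = _ := by rw [e2, e1]
    rw [e] at h
    simp only [J, powerProduct_add, powerProduct_single, map_mul, map_pow]
    exact h
  · intro c
    induction c using Polynomial.induction_on' with
    | add a b ha hb =>
      obtain ⟨P, hP, hP'⟩ := ha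
      obtain ⟨Q, hQ, hQ'⟩ := hb
      refine ⟨P + Q, add_mem hP hQ, ?_⟩
      rw [map_add, map_add, hP', hQ', map_add, add_mul]
    | monomial i c =>
      refine ⟨monomial (Finsupp.single 1 i + J) c, monomial_mem_standardPolys ?_ c, ?_⟩
      · constructor
        · simpa [J] using Nat.mod_lt n hp0
        · simpa [J] using Nat.mod_lt (n / p) hp0
      · rw [aeval_monomial_eq, powerProduct_add, powerProduct_single, map_mul, map_mul, map_pow,
          dehom_C]
        change _ * (dehom p M (fHat₁ p M) ^ i * _) = _
        rw [dehom_fHat₁ H.coeffL_ne_zero, ← Polynomial.C_mul_X_pow_eq_monomial, map_mul, map_pow,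
          mul_assoc]

/-- A nonzero invariant has degree mp⁴, and the standard product of that degree has a unit leading
coefficient. Subtracting an F[t]-multiple of it lowers the degree and keeps invariance. -/
theorem exists_standard_of_isShiftInvariant : ∀ (n : ℕ) (G : Polynomial (Polynomial F)),
    G.degree < n → IsShiftInvariant p M G →
      ∃ P ∈ standardPolys F p, dehom p M (aeval (gens p M) P) = G := by
  intro n
  induction n with
  | zero =>
    intro G hG _
    have : G = 0 := by
      rw [Nat.cast_zero] at hG
      exact Polynomial.degree_eq_bot.mp (Nat.WithBot.lt_zero_iff.mp hG)
    exact ⟨0, zero_mem _, by rw [this, map_zero, map_zero]⟩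
  | succ n ih =>
    intro G hG hinv
    by_cases h0 : G = 0
    · exact ⟨0, zero_mem _, by rw [h0, map_zero, map_zero]⟩
    obtain ⟨m, hm⟩ := hinv.natDegree_eq H.gam1357
    obtain ⟨π, hπ, hπinv, hπs⟩ := H.exists_isUnitLead_standard m
    obtain ⟨u, hu⟩ := hπ.2
    obtain ⟨P, hP, hP'⟩ := hπs (G.leadingCoeff * ↑u⁻¹)
    have hu0 : G.leadingCoeff * ↑u⁻¹ ≠ 0 :=
      mul_ne_zero (Polynomial.leadingCoeff_ne_zero.mpr h0) u⁻¹.isUnit.ne_zero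
    have hlt : (G - Polynomial.C (G.leadingCoeff * ↑u⁻¹) * π).degree < G.degree := by
      refine Polynomial.degree_sub_lt_left ?_ h0 ?_
      · rw [Polynomial.degree_C_mul hu0, Polynomial.degree_eq_natDegree h0,
          Polynomial.degree_eq_natDegree hπ.ne_zero, hm, hπ.1]
      · rw [Polynomial.leadingCoeff_mul, Polynomial.leadingCoeff_C, ← hu, mul_assoc,
          Units.inv_mul, mul_one]
    obtain ⟨Q, hQ, hQ'⟩ := ih (G - Polynomial.C (G.leadingCoeff * ↑u⁻¹) * π)
      (hlt.trans_le (by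
        rw [Polynomial.degree_eq_natDegree h0] at hG ⊢
        have : G.natDegree < n + 1 := by exact_mod_cast hG
        exact_mod_cast Nat.lt_succ_iff.mp this)) (fun g => by
        rw [Polynomial.sub_comp, Polynomial.mul_comp, Polynomial.C_comp, hinv g, hπinv g])
    refine ⟨Q + P, add_mem hQ hP, ?_⟩
    rw [map_add, map_add, hQ', hP', sub_add_cancel]

theorem aeval_gens_eq_sum (P : MvPolynomial (Fin 5) F) :
    aeval (gens p M) P = ∑ I ∈ P.support, C (coeff I P) * powerProduct (gens p M) I := by
  conv_lhs => rw [P.as_sum, map_sum]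
  exact Finset.sum_congr rfl fun I _ => aeval_monomial_eq _ _ _

/-- Standard power products have distinct lead monomials, so no cancellation occurs. -/
theorem exists_degree_eq {P : MvPolynomial (Fin 5) F} (hP : P ∈ standardPolys F p) (h0 : P ≠ 0) :
    ∃ J ∈ P.support, aeval (gens p M) P ≠ 0 ∧
      grevlex.degree (aeval (gens p M) P) = leadExp p J ∧
      ∀ I ∈ P.support, grevlex.toSyn (leadExp p I) ≤ grevlex.toSyn (leadExp p J) := by
  rw [mem_standardPolys] at hP
  obtain ⟨J, hJ, hmax⟩ := P.support.exists_max_image (fun I => grevlex.toSyn (leadExp p I))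
    (support_nonempty.mpr h0)
  have hc : coeff (leadExp p J) (aeval (gens p M) P) ≠ 0 := by
    rw [H.aeval_gens_eq_sum, coeff_sum, Finset.sum_eq_single J, coeff_C_mul,
      ← H.degree_powerProduct]
    · exact mul_ne_zero (mem_support_iff.mp hJ)
        (grevlex.coeff_degree_ne_zero_iff.mpr (H.powerProduct_ne_zero J))
    · intro I hI hIJ
      rw [coeff_C_mul, grevlex.coeff_eq_zero_of_lt, mul_zero]
      rw [H.degree_powerProduct]
      refine lt_of_le_of_ne (hmax I hI) fun h => hIJ ?_
      exact leadExp_injOn H.two_lt (hP I hI) (hP J hJ) (grevlex.toSyn.injective h)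
    · exact fun h => absurd hJ h
  refine ⟨J, hJ, fun h => hc (by rw [h, coeff_zero]), ?_, hmax⟩
  refine degree_eq_of_support_le hc fun e he => not_lt.mp fun hlt => mem_support_iff.mp he ?_
  rw [H.aeval_gens_eq_sum, coeff_sum]
  refine Finset.sum_eq_zero fun I hI => ?_
  rw [coeff_C_mul, grevlex.coeff_eq_zero_of_lt, mul_zero]
  rw [H.degree_powerProduct]
  exact (hmax I hI).trans_lt hlt

/-- The dehomogenized expression for r is padded with powers of x to one for x^k r. Without
cancellation, the largest lead monomial occurring is that of x^k r, so it is divisible by x^k. In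
grevlex, smaller monomials of the same degree have at least as large an exponent of x, so every
power product contains x^k as a power of the generator x. -/
theorem exists_standard_of_isHomogeneous {r : MvPolynomial (Fin 3) F} {d : ℕ}
    (hr : r ∈ invariants p M) (hd : r.IsHomogeneous d) :
    ∃ P ∈ standardPolys F p, aeval (gens p M) P = r := by
  by_cases hr0 : r = 0
  · exact ⟨0, zero_mem _, by rw [map_zero, hr0]⟩
  obtain ⟨P', hP', hPr⟩ := H.exists_standard_of_isShiftInvariant _ (dehom p M r)
    (lt_of_le_of_lt Polynomial.degree_le_natDegree (by exact_mod_cast Nat.lt_succ_self _))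
    (isShiftInvariant_dehom H hr)
  rw [mem_standardPolys] at hP'
  -- This k is large enough for every term to be padded up to degree d + k.
  let k := P'.support.sup (Finsupp.weight (genDegrees p))
  have hk : ∀ I ∈ P'.support, Finsupp.weight (genDegrees p) I ≤ d + k := fun I hI =>
    (Finset.le_sup hI).trans (Nat.le_add_left _ _)
  let lift : (Fin 5 →₀ ℕ) → (Fin 5 →₀ ℕ) := fun I =>
    I + Finsupp.single 0 (d + k - Finsupp.weight (genDegrees p) I)
  have hlift : ∀ I ∈ P'.support, Finsupp.weight (genDegrees p) (lift I) = d + k := fun I hI => by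
    have := hk I hI
    simp only [lift, map_add, Finsupp.weight_single, smul_eq_mul]
    rw [show genDegrees p 0 = 1 from rfl]
    omega
  let P : MvPolynomial (Fin 5) F := ∑ I ∈ P'.support, monomial (lift I) (coeff I P')
  have hP : P ∈ standardPolys F p := sum_mem fun I hI =>
    monomial_mem_standardPolys (by simpa [IsStandard, lift] using hP' I hI) _
  have hPhom : (aeval (gens p M) P).IsHomogeneous (d + k) := by
    rw [map_sum]
    refine IsHomogeneous.sum _ _ _ fun I hI => ?_
    rw [aeval_monomial_eq, ← hlift I hI]
    exact (H.powerProduct_isHomogeneous _).C_mul _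
  have hPd : dehom p M (aeval (gens p M) P) = dehom p M r := by
    rw [← hPr, H.aeval_gens_eq_sum P', map_sum, map_sum, map_sum]
    refine Finset.sum_congr rfl fun I _ => ?_
    rw [aeval_monomial_eq, powerProduct_add, powerProduct_single]
    change dehom p M (_ * (_ * X 2 ^ _)) = _
    rw [map_mul, map_mul, map_mul, map_pow, dehom_X_two, one_pow, mul_one]
  have hPx : aeval (gens p M) P = X 2 ^ k * r := by
    refine sub_eq_zero.mp (eq_zero_of_dehom_eq_zero H.coeffL_ne_zero (d := d + k)
      (hPhom.sub ?_) ?_)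
    · exact isHomogeneous_of_degree_eq ((isHomogeneous_X_pow 2 k).mul hd) (add_comm _ _)
    · rw [map_sub, hPd, map_mul, map_pow, dehom_X_two, one_pow, one_mul, sub_self]
  have hxr : X 2 ^ k * r ≠ 0 := mul_ne_zero (pow_ne_zero _ (X_ne_zero _)) hr0
  have hP0 : P ≠ 0 := by
    rintro h
    rw [h, map_zero] at hPx
    exact hxr hPx.symm
  obtain ⟨J, hJ, -, hdeg, hmax⟩ := H.exists_degree_eq hP hP0
  have hsupp : ∀ I ∈ P.support, Finsupp.weight (genDegrees p) I = d + k := by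
    intro I hI
    obtain ⟨I', hI', hI''⟩ := Finset.mem_biUnion.mp (support_sum hI)
    rw [Finset.mem_singleton.mp (support_monomial_subset hI''), hlift I' hI']
  have hk0 : ∀ I ∈ P.support, k ≤ I 0 := by
    intro I hI
    have h1 : k ≤ J 0 := by
      rw [← leadExp_two (p := p), ← hdeg, hPx,
        grevlex.degree_mul (pow_ne_zero _ (X_ne_zero _)) hr0, grevlex.degree_pow, grevlex.degree_X]
      simp
    have h2 := not_lt.mpr (hmax I hI)
    rw [grevlex_lt_iff, ← degree_fin_three, ← degree_fin_three, degree_leadExp, degree_leadExp,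
      hsupp I hI, hsupp J hJ, leadExp_two, leadExp_two] at h2
    omega
  refine ⟨∑ I ∈ P.support, monomial (I - Finsupp.single 0 k) (coeff I P), sum_mem fun I hI =>
    monomial_mem_standardPolys (by
      simpa [IsStandard] using mem_standardPolys.mp hP I hI) _, ?_⟩
  apply mul_left_cancel₀ (pow_ne_zero k (X_ne_zero (R := F) (2 : Fin 3)))
  rw [← hPx, H.aeval_gens_eq_sum P, map_sum, Finset.mul_sum]
  refine Finset.sum_congr rfl fun I hI => ?_
  have e : I = Finsupp.single 0 k + (I - Finsupp.single 0 k) :=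
    (add_tsub_cancel_of_le (Finsupp.single_le_iff.mpr (hk0 I hI))).symm
  have e' : powerProduct (gens p M) I
      = X 2 ^ k * powerProduct (gens p M) (I - Finsupp.single 0 k) := by
    conv_lhs => rw [e, powerProduct_add, powerProduct_single]
    rfl
  rw [aeval_monomial_eq, e', mul_left_comm]

theorem exists_standard {r : MvPolynomial (Fin 3) F} (hr : r ∈ invariants p M) :
    ∃ P ∈ standardPolys F p, aeval (gens p M) P = r := by
  have h : ∀ n, ∃ P ∈ standardPolys F p, aeval (gens p M) P = homogeneousComponent n r := fun n =>
    H.exists_standard_of_isHomogeneous (homogeneousComponent_mem_invariants hr n)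
      (homogeneousComponent_isHomogeneous n r)
  choose P hP hPr using h
  refine ⟨∑ n ∈ Finset.range (r.totalDegree + 1), P n, sum_mem fun n _ => hP n, ?_⟩
  rw [map_sum, Finset.sum_congr rfl fun n _ => hPr n, sum_homogeneousComponent]

theorem exists_leadExp_eq {r : MvPolynomial (Fin 3) F} (hr : r ∈ invariants p M) (hr0 : r ≠ 0) :
    ∃ I, IsStandard p I ∧ grevlex.degree r = leadExp p I := by
  obtain ⟨P, hP, rfl⟩ := H.exists_standard hr
  obtain ⟨J, hJ, -, hdeg, -⟩ := H.exists_degree_eq hP fun h => hr0 (by rw [h, map_zero])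
  exact ⟨J, mem_standardPolys.mp hP J hJ, hdeg⟩

end Admissible

/-! ### Subduction -/

theorem leadTerm_eq_iff {f g : MvPolynomial (Fin 3) F} : leadTerm f = leadTerm g ↔
    grevlex.degree f = grevlex.degree g ∧ grevlex.leadingCoeff f = grevlex.leadingCoeff g := by
  rw [leadTerm, leadTerm, grevlex.leadingTerm_eq_leadingTerm_iff, and_comm]

theorem degree_sub_lt_of_leadTerm_eq {f g : MvPolynomial (Fin 3) F} (h : leadTerm f = leadTerm g)
    (hne : f - g ≠ 0) :
    grevlex.toSyn (grevlex.degree (f - g)) < grevlex.toSyn (grevlex.degree f) := by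
  obtain ⟨h1, h2⟩ := leadTerm_eq_iff.mp h
  refine lt_of_le_of_ne ?_ fun heq => ?_
  · have := grevlex.degree_sub_le (f := f) (g := g)
    rwa [← h1, sup_idem] at this
  · have h3 := grevlex.toSyn.injective heq
    apply grevlex.coeff_degree_ne_zero_iff.mpr hne
    rw [h3, coeff_sub]
    change grevlex.leadingCoeff f - _ = 0
    rw [h1, h2]
    exact sub_self _

theorem degree_C_mul {c : F} (hc : c ≠ 0) (f : MvPolynomial (Fin 3) F) :
    grevlex.degree (C c * f) = grevlex.degree f := by
  by_cases hf : f = 0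
  · rw [hf, mul_zero]
  · rw [grevlex.degree_mul (C_ne_zero.mpr hc) hf, grevlex.degree_C, zero_add]

theorem leadTerm_eq_leadTerm_C_mul {f g : MvPolynomial (Fin 3) F} (hf : f ≠ 0) (hg : g ≠ 0)
    (h : grevlex.degree f = grevlex.degree g) :
    leadTerm f = leadTerm (C (grevlex.leadingCoeff f / grevlex.leadingCoeff g) * g) := by
  have hf' := grevlex.leadingCoeff_ne_zero_iff.mpr hf
  have hg' := grevlex.leadingCoeff_ne_zero_iff.mpr hg
  rw [leadTerm_eq_iff, degree_C_mul (div_ne_zero hf' hg'), grevlex.leadingCoeff_mul,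
    grevlex.leadingCoeff_C, div_mul_cancel₀ _ hg']
  exact ⟨h, rfl⟩

theorem ne_zero_of_leadTerm_eq {f g : MvPolynomial (Fin 3) F} (hf : f ≠ 0)
    (h : leadTerm f = leadTerm g) : g ≠ 0 := by
  rintro rfl
  rw [leadTerm, leadTerm, grevlex.leadingTerm_zero] at h
  exact hf ((grevlex.leadingTerm_eq_zero_iff f).mp h)

theorem SubductsToZero.aeval_eq {n : ℕ} {h : Fin n → MvPolynomial (Fin 3) F}
    {f : MvPolynomial (Fin 3) F} {P : MvPolynomial (Fin n) F} (hP : SubductsToZero h f P) :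
    aeval h P = f := by
  induction hP with
  | zero => exact map_zero _
  | step f I c P _ _ _ ih => rw [map_add, ih, aeval_monomial_eq, add_sub_cancel]

/-- The clause `f ≠ 0` is carried through the induction so that the strict drop of the lead monomial
applies to the remaining difference. -/
theorem SubductsToZero.degree_le {n : ℕ} {h : Fin n → MvPolynomial (Fin 3) F}
    {f : MvPolynomial (Fin 3) F} {P : MvPolynomial (Fin n) F} (hP : SubductsToZero h f P) :
    ∀ I ∈ P.support, f ≠ 0 ∧ grevlex.toSyn (grevlex.degree (powerProduct h I))
      ≤ grevlex.toSyn (grevlex.degree f) := by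
  classical
  induction hP with
  | zero => simp
  | step f I c P hf hlt hP ih =>
    intro K hK
    refine ⟨hf, ?_⟩
    rcases Finset.mem_union.mp (support_add hK) with hK | hK
    · rw [Finset.mem_singleton.mp (support_monomial_subset hK)]
      have h1 := (leadTerm_eq_iff.mp hlt).1
      have hc : c ≠ 0 := by
        rintro rfl
        exact ne_zero_of_leadTerm_eq hf hlt (by rw [C_0, zero_mul])
      rw [h1, degree_C_mul hc]
    · obtain ⟨h1, h2⟩ := ih K hK
      exact h2.trans (degree_sub_lt_of_leadTerm_eq hlt h1).le

namespace Admissible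

variable (H : Admissible p M)
include H

/-- Each subtracted power product shares the lead monomial of a form of degree d, which forces its
weight to be d. -/
theorem subductsToZero_isWeightedHomogeneous {f : MvPolynomial (Fin 3) F}
    {P : MvPolynomial (Fin 5) F} (hP : SubductsToZero (gens p M) f P) {d : ℕ}
    (hd : f.IsHomogeneous d) : P.IsWeightedHomogeneous (genDegrees p) d := by
  induction hP with
  | zero => exact isWeightedHomogeneous_zero _ _ _
  | step f I c P hf hlt hP ih =>
    have hc : c ≠ 0 := by
      rintro rfl
      exact ne_zero_of_leadTerm_eq hf hlt (by rw [C_0, zero_mul])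
    have hI : Finsupp.weight (genDegrees p) I = d := by
      have h1 := (leadTerm_eq_iff.mp hlt).1
      rw [degree_C_mul hc, H.degree_powerProduct] at h1
      rw [← degree_leadExp, ← h1]
      exact degree_eq_of_mem_support hd (grevlex.degree_mem_support hf)
    refine (isWeightedHomogeneous_monomial _ _ _ hI).add (ih (hd.sub ?_))
    rw [← hI]
    exact (H.powerProduct_isHomogeneous I).C_mul c

/-- Every nonzero invariant has the lead monomial of some power product, and the difference is again
invariant. Grevlex is a well-order, so the process stops. -/
theorem exists_subductsToZero : ∀ (s : grevlex.syn) (f : MvPolynomial (Fin 3) F),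
    grevlex.toSyn (grevlex.degree f) = s → f ∈ invariants p M →
      ∃ P, SubductsToZero (gens p M) f P := by
  intro s
  induction s using WellFoundedLT.induction with
  | _ s ih =>
  intro f hs hf
  by_cases hf0 : f = 0
  · exact ⟨0, hf0 ▸ SubductsToZero.zero⟩
  obtain ⟨I, -, hI⟩ := H.exists_leadExp_eq hf hf0
  have hlt := leadTerm_eq_leadTerm_C_mul hf0 (H.powerProduct_ne_zero I)
    (hI.trans (H.degree_powerProduct I).symm)
  set c := grevlex.leadingCoeff f / grevlex.leadingCoeff (powerProduct (gens p M) I)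
  have hmem : f - C c * powerProduct (gens p M) I ∈ invariants p M :=
    sub_mem hf (mul_mem (fun g => act_C g c) (H.powerProduct_mem I))
  by_cases h0 : f - C c * powerProduct (gens p M) I = 0
  · exact ⟨monomial I c + 0, SubductsToZero.step f I c 0 hf0 hlt (h0 ▸ SubductsToZero.zero)⟩
  · obtain ⟨P, hP⟩ := ih _ (hs ▸ degree_sub_lt_of_leadTerm_eq hlt h0) _ rfl hmem
    exact ⟨monomial I c + P, SubductsToZero.step f I c P hf0 hlt hP⟩

theorem exists_isSubductionRelation {I J : Fin 5 →₀ ℕ} (h : leadExp p I = leadExp p J) :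
    ∃ r, IsSubductionRelation (gens p M) I J r := by
  have hlt := leadTerm_eq_leadTerm_C_mul (H.powerProduct_ne_zero I) (H.powerProduct_ne_zero J)
    (by rw [H.degree_powerProduct, H.degree_powerProduct, h])
  obtain ⟨P, hP⟩ := H.exists_subductsToZero _ _ rfl
    (sub_mem (H.powerProduct_mem I) (mul_mem (fun g => act_C g _) (H.powerProduct_mem J)))
  exact ⟨_, _, P, hlt, hP, rfl⟩

end Admissible

/-! ### A monomial order on the polynomial ring in the generators -/

/-- Exponents of power products of the generators, ordered first by lead monomial. -/
def GenExponent (_p : ℕ) : Type := Fin 5 →₀ ℕ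

instance : AddCommMonoid (GenExponent p) := inferInstanceAs (AddCommMonoid (Fin 5 →₀ ℕ))

variable (p) in
/-- The identity map to the type synonym. -/
def toGenExponent : (Fin 5 →₀ ℕ) ≃+ GenExponent p := AddEquiv.refl _

/-- The total degree and the `(y, z)`-degree of the lead monomial, followed by the exponents of
`N_M(z)`, `h₃` and `h₂`. -/
def genKey (a : GenExponent p) : ℕ ×ₗ ℕ ×ₗ ℕ ×ₗ ℕ ×ₗ ℕ :=
  let I := (toGenExponent p).symm a
  toLex (I 0 + (p ^ 2 * I 1 + (p ^ 2 + p) * I 2 + (p ^ 3 + p + 2) * I 3 + p ^ 4 * I 4),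
    toLex (p ^ 2 * I 1 + (p ^ 2 + p) * I 2 + (p ^ 3 + p + 2) * I 3 + p ^ 4 * I 4,
      toLex (I 4, toLex (I 3, I 2))))

theorem genKey_injective : Function.Injective (genKey (p := p)) := by
  intro a b h
  simp only [genKey, EmbeddingLike.apply_eq_iff_eq, Prod.mk.injEq] at h
  obtain ⟨h1, h2, h3, h4, h5⟩ := h
  rw [h3, h4, h5] at h2
  have hp : 0 < p ^ 2 := pow_pos (Fact.out : p.Prime).pos 2
  have h6 : p ^ 2 * (toGenExponent p).symm a 1 = p ^ 2 * (toGenExponent p).symm b 1 := by omega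
  have h7 := Nat.eq_of_mul_eq_mul_left hp h6
  apply (toGenExponent p).symm.injective
  ext i
  fin_cases i
  · simp only [Fin.zero_eta]
    rw [h3, h4, h5, h7] at h1
    omega
  · exact h7
  · exact h5
  · exact h4
  · exact h3

theorem genKey_add (a b : GenExponent p) : genKey (a + b) = genKey a + genKey b := by
  simp only [genKey, map_add, Finsupp.add_apply, ← toLex_add, Prod.mk_add_mk]
  refine congrArg toLex (Prod.ext ?_ (congrArg toLex (Prod.ext ?_ rfl))) <;> simp only <;> ring

instance : LinearOrder (GenExponent p) := LinearOrder.lift' genKey genKey_injective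

theorem genKey_le {a b : GenExponent p} : genKey a ≤ genKey b ↔ a ≤ b := Iff.rfl

instance : IsOrderedAddMonoid (GenExponent p) where
  add_le_add_left a b h c := by
    rw [← genKey_le] at h ⊢
    rw [genKey_add, genKey_add]
    exact add_le_add_left h _

instance : WellFoundedLT (GenExponent p) :=
  ⟨InvImage.wf genKey (wellFounded_lt (α := ℕ ×ₗ ℕ ×ₗ ℕ ×ₗ ℕ ×ₗ ℕ))⟩

variable (p) in
/-- The monomial order on `F[T₀, …, T₄]` refining the order of lead monomials. -/
def genOrder : MonomialOrder (Fin 5) where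
  syn := GenExponent p
  toSyn := toGenExponent p
  toSyn_monotone a b h := by
    obtain ⟨c, rfl⟩ := exists_add_of_le h
    rw [map_add, ← genKey_le, genKey_add]
    refine le_add_of_nonneg_right ?_
    simp only [genKey, AddEquiv.symm_apply_apply]
    rw [show (0 : ℕ ×ₗ ℕ ×ₗ ℕ ×ₗ ℕ ×ₗ ℕ) = toLex (0, toLex (0, toLex (0, toLex (0, 0)))) from rfl]
    simp only [Prod.Lex.toLex_le_toLex]
    omega

/-- The first three entries of `genKey` encode grevlex: at equal total degree, a smaller x-exponent
is a larger (y, z)-degree, and then a smaller y-exponent is a larger z-exponent p⁴I₄. -/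
theorem genOrder_lt_of_leadExp_lt {I J : Fin 5 →₀ ℕ}
    (h : grevlex.toSyn (leadExp p I) < grevlex.toSyn (leadExp p J)) :
    (genOrder p).toSyn I < (genOrder p).toSyn J := by
  have hp : 0 < p ^ 4 := pow_pos (Fact.out : p.Prime).pos 4
  rw [grevlex_lt_iff] at h
  simp only [leadExp_zero, leadExp_one, leadExp_two] at h
  change genKey (toGenExponent p I) < genKey (toGenExponent p J)
  simp only [genKey, AddEquiv.symm_apply_apply, Prod.Lex.toLex_lt_toLex]
  rcases h with h | ⟨h1, h | ⟨h2, h3⟩⟩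
  · left; omega
  · right; omega
  · right
    refine ⟨by omega, Or.inr ⟨by omega, Or.inl ?_⟩⟩
    have : p ^ 4 * I 4 < p ^ 4 * J 4 := by omega
    exact Nat.lt_of_mul_lt_mul_left this

/-- The tie-break puts T₂^p above T₁^{p+1} and T₃^p above T₁^{p²-1}T₂². -/
theorem genOrder_lt_of_leadExp_eq (hp : 0 < p) {I J : Fin 5 →₀ ℕ} (h : leadExp p I = leadExp p J)
    (h' : I 3 < J 3 ∨ I 3 = J 3 ∧ I 2 < J 2) :
    (genOrder p).toSyn I < (genOrder p).toSyn J := by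
  have h0 := DFunLike.congr_fun h 0
  have h1 := DFunLike.congr_fun h 1
  have h2 := DFunLike.congr_fun h 2
  simp only [leadExp_zero, leadExp_one, leadExp_two] at h0 h1 h2
  have h4 : I 4 = J 4 := Nat.eq_of_mul_eq_mul_left (pow_pos hp 4) h0
  change genKey (toGenExponent p I) < genKey (toGenExponent p J)
  simp only [genKey, AddEquiv.symm_apply_apply, Prod.Lex.toLex_lt_toLex]
  omega

namespace Admissible

variable (H : Admissible p M)
include H

/-- Terms recorded by the subduction map strictly below the common lead monomial, and T^J lies below
T^I by hypothesis. So T^I leads with coefficient 1 whichever subduction is chosen. -/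
theorem isSubductionRelation_spec {I J : Fin 5 →₀ ℕ} (h : leadExp p I = leadExp p J)
    (h' : (genOrder p).toSyn J < (genOrder p).toSyn I) {r : MvPolynomial (Fin 5) F}
    (hr : IsSubductionRelation (gens p M) I J r) :
    (genOrder p).degree r = I ∧ r ≠ 0 ∧ aeval (gens p M) r = 0 ∧
      r.IsWeightedHomogeneous (genDegrees p) (Finsupp.weight (genDegrees p) I) := by
  obtain ⟨c, P, hlt, hP, rfl⟩ := hr
  have hJI : Finsupp.weight (genDegrees p) J = Finsupp.weight (genDegrees p) I := by
    rw [← degree_leadExp, ← degree_leadExp, h]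
  have hsmall : ∀ K ∈ P.support, (genOrder p).toSyn K < (genOrder p).toSyn I := by
    intro K hK
    obtain ⟨h1, h2⟩ := hP.degree_le K hK
    have h3 := h2.trans_lt (degree_sub_lt_of_leadTerm_eq hlt h1)
    rw [H.degree_powerProduct, H.degree_powerProduct] at h3
    exact genOrder_lt_of_leadExp_lt h3
  have hcoeff : ∀ K, (genOrder p).toSyn I ≤ (genOrder p).toSyn K →
      coeff K (monomial I 1 - monomial J c - P) = if I = K then 1 else 0 := by
    classical
    intro K hK
    have hPK : coeff K P = 0 := by
      by_contra hne
      exact absurd (hsmall K (mem_support_iff.mpr hne)) (not_lt.mpr hK)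
    have hJK : J ≠ K := by
      rintro rfl
      exact absurd h' (not_lt.mpr hK)
    rw [coeff_sub, coeff_sub, coeff_monomial, coeff_monomial, if_neg hJK, hPK, sub_zero, sub_zero]
  have hI : coeff I (monomial I 1 - monomial J c - P) ≠ 0 := by
    rw [hcoeff I le_rfl, if_pos rfl]
    exact one_ne_zero
  refine ⟨?_, fun h0 => hI (by rw [h0, coeff_zero]), ?_, ?_⟩
  · apply (genOrder p).toSyn.injective
    refine le_antisymm ((genOrder p).degree_le_iff.mpr fun K hK => not_lt.mp fun hlt' => ?_)
      ((genOrder p).le_degree (mem_support_iff.mpr hI))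
    refine mem_support_iff.mp hK ?_
    rw [hcoeff K hlt'.le, if_neg]
    rintro rfl
    exact lt_irrefl _ hlt'
  · rw [map_sub, map_sub, hP.aeval_eq, aeval_monomial_eq, aeval_monomial_eq, C_1, one_mul, sub_self]
  · have hhom := H.subductsToZero_isWeightedHomogeneous hP
      ((H.powerProduct_isHomogeneous I).sub (by
        rw [← hJI]
        exact (H.powerProduct_isHomogeneous J).C_mul c))
    rw [← mem_weightedHomogeneousSubmodule] at hhom ⊢
    exact sub_mem (sub_mem (isWeightedHomogeneous_monomial _ _ _ rfl)
      (isWeightedHomogeneous_monomial _ _ _ hJI)) hhom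

/-- Division by r₁ and r₂ leaves a remainder with no term divisible by T₂^p or T₃^p, hence standard.
A nonzero standard polynomial has nonzero image, so a kernel element has remainder 0. -/
theorem ker_eq_span {r₁ r₂ : MvPolynomial (Fin 5) F}
    (h₁ : (genOrder p).degree r₁ = Finsupp.single 2 p)
    (h₁0 : r₁ ≠ 0) (h₁' : aeval (gens p M) r₁ = 0)
    (h₂ : (genOrder p).degree r₂ = Finsupp.single 3 p) (h₂0 : r₂ ≠ 0)
    (h₂' : aeval (gens p M) r₂ = 0) :
    RingHom.ker (aeval (gens p M) : MvPolynomial (Fin 5) F →ₐ[F] MvPolynomial (Fin 3) F)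
      = Ideal.span {r₁, r₂} := by
  apply le_antisymm
  · intro f hf
    rw [RingHom.mem_ker] at hf
    obtain ⟨g, r, hfr, -, hr⟩ := (genOrder p).div_set (B := {r₁, r₂}) (by
      rintro b (rfl | rfl)
      · exact isUnit_iff_ne_zero.mpr ((genOrder p).leadingCoeff_ne_zero_iff.mpr h₁0)
      · exact isUnit_iff_ne_zero.mpr ((genOrder p).leadingCoeff_ne_zero_iff.mpr h₂0)) f
    have hspan : Finsupp.linearCombination (MvPolynomial (Fin 5) F)
        (fun b : ({r₁, r₂} : Set (MvPolynomial (Fin 5) F)) => (b : MvPolynomial (Fin 5) F)) g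
          ∈ Ideal.span {r₁, r₂} := by
      rw [Finsupp.linearCombination_apply, Finsupp.sum]
      exact sum_mem fun b _ => Ideal.mul_mem_left _ _ (Ideal.subset_span b.2)
    have hspan0 : ∀ q ∈ Ideal.span {r₁, r₂}, aeval (gens p M) q = 0 := by
      intro q hq
      have : Ideal.span {r₁, r₂} ≤ RingHom.ker (aeval (gens p M) :
          MvPolynomial (Fin 5) F →ₐ[F] MvPolynomial (Fin 3) F) := by
        rw [Ideal.span_le]
        rintro b (rfl | rfl)
        · exact h₁'
        · exact h₂'
      exact this hq
    have hr0 : r = 0 := by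
      by_contra hne
      have hstd : r ∈ standardPolys F p := by
        rw [mem_standardPolys]
        intro I hI
        have e1 := hr I hI r₁ (by simp)
        have e2 := hr I hI r₂ (by simp)
        rw [h₁, Finsupp.single_le_iff, not_le] at e1
        rw [h₂, Finsupp.single_le_iff, not_le] at e2
        exact ⟨e1, e2⟩
      obtain ⟨-, -, h0, -⟩ := H.exists_degree_eq hstd hne
      apply h0
      rw [hfr, map_add, hspan0 _ hspan, zero_add] at hf
      exact hf
    rw [hfr, hr0, add_zero]
    exact hspan
  · rw [Ideal.span_le]
    rintro b (rfl | rfl)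
    · exact h₁'
    · exact h₂'

end Admissible

/-- Polynomials whose lead monomials are powers of distinct variables are coprime. -/
theorem dvd_of_mul_eq_mul {σ : Type*} (m : MonomialOrder σ) {f g x y : MvPolynomial σ F} {i j : σ}
    {a b : ℕ} (hij : i ≠ j) (hf : f ≠ 0) (hg : g ≠ 0) (hfi : m.degree f = Finsupp.single i a)
    (hgj : m.degree g = Finsupp.single j b) (h : g * x = f * y) : f ∣ x := by
  obtain ⟨q, r, hx, -, hr⟩ := m.div_single (b := f)
    (isUnit_iff_ne_zero.mpr (m.leadingCoeff_ne_zero_iff.mpr hf)) x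
  by_cases hr0 : r = 0
  · exact ⟨q, by rw [hx, hr0, add_zero, mul_comm]⟩
  exfalso
  have h' : g * r = f * (y - g * q) := by
    rw [hx] at h
    linear_combination h
  have hy : y - g * q ≠ 0 := by
    intro h0
    rw [h0, mul_zero] at h'
    exact mul_ne_zero hg hr0 h'
  -- The lead monomial of g does not involve the i-th variable, so that of the remainder r must
  -- absorb its a-th power, which division by f forbids.
  have hdeg := congrArg m.degree h'
  rw [m.degree_mul hg hr0, m.degree_mul hf hy, hfi, hgj] at hdeg
  refine hr _ (m.degree_mem_support hr0) ?_
  rw [hfi, Finsupp.single_le_iff]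
  have := DFunLike.congr_fun hdeg i
  simp [Finsupp.single_eq_of_ne hij] at this
  omega

theorem isRegular_pair {R : Type*} [CommRing R] [IsDomain R] {r₁ r₂ : R} (h₁ : r₁ ≠ 0)
    (h : ∀ x y, r₂ * x = r₁ * y → r₁ ∣ x) (htop : Ideal.span {r₁, r₂} ≠ ⊤) :
    RingTheory.Sequence.IsRegular R [r₁, r₂] := by
  refine ⟨?_, ?_⟩
  · rw [RingTheory.Sequence.isWeaklyRegular_cons_iff,
      RingTheory.Sequence.isWeaklyRegular_singleton_iff]
    refine ⟨fun x y hxy => mul_left_cancel₀ h₁ hxy, ?_⟩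
    rw [isSMulRegular_quotient_iff_mem_of_smul_mem]
    intro x hx
    obtain ⟨y, -, hy⟩ := (Submodule.mem_smul_pointwise_iff_exists _ _ _).mp hx
    obtain ⟨z, hz⟩ := h x y hy.symm
    exact (Submodule.mem_smul_pointwise_iff_exists _ _ _).mpr ⟨z, trivial, hz.symm⟩
  · intro htop'
    apply htop
    rw [smul_eq_mul, Ideal.mul_top, Ideal.ofList_cons, Ideal.ofList_singleton,
      ← Ideal.span_insert] at htop'
    exact htop'.symm

/-! ### The structure of the ring of invariants -/

theorem leadExp_single_two : leadExp p (Finsupp.single 2 p)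
    = leadExp p (Finsupp.single 1 (p + 1)) := by
  ext i
  fin_cases i
  · simp [leadExp_zero]
  · simp [leadExp_one]; ring
  · simp [leadExp_two]

theorem leadExp_single_three (hp : 0 < p) : leadExp p (Finsupp.single 3 p)
    = leadExp p (Finsupp.single 1 (p ^ 2 - 1) + Finsupp.single 2 2) := by
  -- The y-exponents agree because p(p³ + p + 2) = p²(p² − 1) + 2(p² + p); m replaces the truncated
  -- p² − 1.
  obtain ⟨m, hm⟩ : ∃ m, p ^ 2 = m + 1 := ⟨p ^ 2 - 1, by have := pow_pos hp 2; omega⟩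
  ext i
  fin_cases i
  · simp [leadExp_zero]
  · have e : p ^ 2 - 1 = m := by omega
    have e4 : p ^ 4 = p ^ 2 * (m + 1) := by rw [← hm]; ring
    simp [leadExp_one, e]
    linarith [e4]
  · simp [leadExp_two]

theorem isCompleteIntersection_of_pair {A : Subalgebra F (MvPolynomial (Fin 3) F)} {n : ℕ}
    {h : Fin n → MvPolynomial (Fin 3) F} (hA : Algebra.adjoin F (Set.range h) = A)
    {r₁ r₂ : MvPolynomial (Fin n) F}
    (hreg : RingTheory.Sequence.IsRegular (MvPolynomial (Fin n) F) [r₁, r₂])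
    (hker : RingHom.ker (aeval h : MvPolynomial (Fin n) F →ₐ[F] MvPolynomial (Fin 3) F)
      = Ideal.span {r₁, r₂}) : IsCompleteIntersection F A := by
  have hrange : (aeval h : MvPolynomial (Fin n) F →ₐ[F] MvPolynomial (Fin 3) F).range = A := by
    rw [← Algebra.adjoin_range_eq_range_aeval, hA]
  have hmem : ∀ P, aeval h P ∈ A := fun P => hrange ▸ AlgHom.mem_range_self _ P
  refine ⟨n, (aeval h).codRestrict A hmem, [r₁, r₂], ?_, hreg, ?_⟩
  · rintro ⟨a, ha⟩
    rw [← hrange] at ha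
    obtain ⟨P, hP⟩ := ha
    exact ⟨P, Subtype.ext hP⟩
  · rw [Ideal.ofList_cons, Ideal.ofList_singleton, ← Ideal.span_insert, ← hker]
    ext P
    rw [RingHom.mem_ker, RingHom.mem_ker, ← Subtype.coe_inj]
    rfl

namespace Admissible

variable (H : Admissible p M)
include H

theorem adjoin_gens : Algebra.adjoin F (Set.range (gens p M)) = invariants p M := by
  apply le_antisymm
  · rw [Algebra.adjoin_le_iff]
    rintro _ ⟨i, rfl⟩
    exact H.gens_mem i
  · intro r hr
    obtain ⟨P, -, rfl⟩ := H.exists_standard hr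
    rw [Algebra.adjoin_range_eq_range_aeval]
    exact AlgHom.mem_range_self _ P

theorem isSagbiBasis_gens : IsSagbiBasis (Set.range (gens p M)) (invariants p M) := by
  have hsub : Set.range (gens p M) ⊆ invariants p M := by
    rintro _ ⟨i, rfl⟩
    exact H.gens_mem i
  refine ⟨hsub, le_antisymm (Algebra.adjoin_mono
    (Set.image_mono fun f hf => ⟨hsub hf.1, hf.2⟩)) ?_⟩
  rw [Algebra.adjoin_le_iff]
  rintro _ ⟨f, ⟨hf, hf0⟩, rfl⟩
  obtain ⟨I, -, hI⟩ := H.exists_leadExp_eq hf hf0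
  have h : leadMonomial f = ∏ i, leadMonomial (gens p M i) ^ I i := by
    have hdeg : grevlex.degree f = ∑ i, I i • grevlex.degree (gens p M i) := by
      rw [hI, ← H.degree_powerProduct, powerProduct,
        grevlex.degree_prod fun i _ => pow_ne_zero _ (H.degree_gens i).2]
      simp only [grevlex.degree_pow]
    simp only [leadMonomial, monomial_pow, one_pow, hdeg, Fin.sum_univ_five, Fin.prod_univ_five,
      monomial_mul, mul_one]
  rw [h]
  have hgen : ∀ i, leadMonomial (gens p M i) ∈
      leadMonomial '' {f | f ∈ Set.range (gens p M) ∧ f ≠ 0} := fun i =>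
    ⟨_, ⟨⟨i, rfl⟩, (H.degree_gens i).2⟩, rfl⟩
  exact prod_mem fun i _ => pow_mem (Algebra.subset_adjoin (hgen i)) _

theorem isNontrivialTeteATete {I J : Fin 5 →₀ ℕ} (h : leadExp p I = leadExp p J)
    (hd : Disjoint I.support J.support) : IsNontrivialTeteATete (gens p M) I J :=
  ⟨by rw [leadMonomial, leadMonomial, H.degree_powerProduct, H.degree_powerProduct, h], hd⟩

theorem subductionRelations {r₁ r₂ : MvPolynomial (Fin 5) F}
    (h₁ : IsSubductionRelation (gens p M) (Finsupp.single 2 p) (Finsupp.single 1 (p + 1)) r₁)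
    (h₂ : IsSubductionRelation (gens p M) (Finsupp.single 3 p)
      (Finsupp.single 1 (p ^ 2 - 1) + Finsupp.single 2 2) r₂) :
    r₁.IsWeightedHomogeneous (genDegrees p) (p ^ 3 + p ^ 2) ∧
      r₂.IsWeightedHomogeneous (genDegrees p) (p ^ 4 + p ^ 2 + 2 * p) ∧
      RingHom.ker (aeval (gens p M) : MvPolynomial (Fin 5) F →ₐ[F] MvPolynomial (Fin 3) F) =
        Ideal.span {r₁, r₂} ∧
      RingTheory.Sequence.IsRegular (MvPolynomial (Fin 5) F) [r₁, r₂] := by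
  have hp : 0 < p := by have := H.two_lt; omega
  obtain ⟨d₁, n₁, a₁, w₁⟩ := H.isSubductionRelation_spec leadExp_single_two
    (genOrder_lt_of_leadExp_eq hp leadExp_single_two.symm (Or.inr (by simpa using hp))) h₁
  obtain ⟨d₂, n₂, a₂, w₂⟩ := H.isSubductionRelation_spec (leadExp_single_three hp)
    (genOrder_lt_of_leadExp_eq hp (leadExp_single_three hp).symm (Or.inl (by simpa using hp))) h₂
  have hker := H.ker_eq_span d₁ n₁ a₁ d₂ n₂ a₂
  refine ⟨?_, ?_, hker, isRegular_pair n₁ (fun x y hxy =>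
    dvd_of_mul_eq_mul (genOrder p) (by decide) n₁ n₂ d₁ d₂ hxy) ?_⟩
  · convert w₁ using 1
    simp [weight_genDegrees]
    ring
  · convert w₂ using 1
    simp [weight_genDegrees]
    ring
  · rw [← hker]
    exact RingHom.ker_ne_top _

end Admissible

end

end RankFourInvariants

/-! ### The main theorem -/

theorem mainTheorem4 {F : Type*} [Field F] (p : ℕ) [Fact p.Prime] (hp : 2 < p) [CharP F p]
    (M : Matrix (Fin 2) (Fin 4) F)
    (h1234 : gam p M 1 2 3 4 ≠ 0) (h1235 : gam p M 1 2 3 5 = 0)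
    (h1357 : gam p M 1 3 5 7 ≠ 0) (h1245 : gam p M 1 2 4 5 ≠ 0) :
    -- the divisions by powers of `x` in the definitions of `h₂` and `h₃` are exact
    (X 2 ^ (p ^ 4 - p ^ 2 - p) ∣ hTilde₂ p M ∧ X 2 ^ (p ^ 2 - p - 2) ∣ hTilde₃ p M) ∧
    -- SAGBI basis, generating set, degrees of the generators
    IsSagbiBasis (Set.range (gens p M)) (invariants p M) ∧
    Algebra.adjoin F (Set.range (gens p M)) = invariants p M ∧
    (∀ i, gens p M i ≠ 0 ∧ (gens p M i).IsHomogeneous (genDegrees p i)) ∧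
    -- complete intersection
    IsCompleteIntersection F (invariants p M) ∧
    -- `(h₂^p, f̂₁^{p+1})` and `(h₃^p, f̂₁^{p²-1} h₂²)` are non-trivial and subduct to zero
    IsNontrivialTeteATete (gens p M) (Finsupp.single 2 p) (Finsupp.single 1 (p + 1)) ∧
    IsNontrivialTeteATete (gens p M) (Finsupp.single 3 p)
      (Finsupp.single 1 (p ^ 2 - 1) + Finsupp.single 2 2) ∧
    (∃ r₁, IsSubductionRelation (gens p M) (Finsupp.single 2 p) (Finsupp.single 1 (p + 1)) r₁) ∧
    (∃ r₂, IsSubductionRelation (gens p M) (Finsupp.single 3 p)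
      (Finsupp.single 1 (p ^ 2 - 1) + Finsupp.single 2 2) r₂) ∧
    -- the relations coming from any such subductions form a regular sequence that generates the
    -- ideal of relations among the generators
    ∀ r₁ r₂ : MvPolynomial (Fin 5) F,
      IsSubductionRelation (gens p M) (Finsupp.single 2 p) (Finsupp.single 1 (p + 1)) r₁ →
      IsSubductionRelation (gens p M) (Finsupp.single 3 p)
        (Finsupp.single 1 (p ^ 2 - 1) + Finsupp.single 2 2) r₂ →
      r₁.IsWeightedHomogeneous (genDegrees p) (p ^ 3 + p ^ 2) ∧
      r₂.IsWeightedHomogeneous (genDegrees p) (p ^ 4 + p ^ 2 + 2 * p) ∧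
      RingHom.ker (aeval (gens p M) : MvPolynomial (Fin 5) F →ₐ[F] MvPolynomial (Fin 3) F) =
        Ideal.span {r₁, r₂} ∧
      RingTheory.Sequence.IsRegular (MvPolynomial (Fin 5) F) [r₁, r₂] := by
  have H : Admissible p M := ⟨hp, h1234, h1235, h1357, h1245⟩
  have hp0 : 0 < p := by omega
  obtain ⟨w₂, hw₂⟩ := exists_hTilde₂_eq hp h1234 h1357
  obtain ⟨w₃, hw₃⟩ := exists_hTilde₃_eq hp h1234 h1235 h1357 h1245
  obtain ⟨r₁, hr₁⟩ := H.exists_isSubductionRelation leadExp_single_two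
  obtain ⟨r₂, hr₂⟩ := H.exists_isSubductionRelation (leadExp_single_three hp0)
  obtain ⟨-, -, hker, hreg⟩ := H.subductionRelations hr₁ hr₂
  refine ⟨⟨⟨_, hw₂⟩, ⟨_, hw₃⟩⟩, H.isSagbiBasis_gens, H.adjoin_gens,
    fun i => ⟨(H.degree_gens i).2, H.gens_isHomogeneous i⟩,
    isCompleteIntersection_of_pair H.adjoin_gens hreg hker,
    H.isNontrivialTeteATete leadExp_single_two ?_,
    H.isNontrivialTeteATete (leadExp_single_three hp0) ?_, ⟨r₁, hr₁⟩, ⟨r₂, hr₂⟩,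
    fun _ _ => H.subductionRelations⟩
  · rw [Finset.disjoint_left]
    intro i hi hi'
    have e1 := Finset.mem_singleton.mp (Finsupp.support_single_subset hi)
    subst e1
    simp at hi'
  · rw [Finset.disjoint_left]
    intro i hi hi'
    have e1 := Finset.mem_singleton.mp (Finsupp.support_single_subset hi)
    subst e1
    simp at hi'
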